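/- Conventions. Hilbert spaces are complex. An affine isomorphism $\psi:E\to F$ between Hilbert spaces is a bijection of the form $\psi(h)=Th+x$ with $T$ linear; its norm is $\|\psi\|:=\|T\|$. \emph{u.b. a-T-menability.} A finitely generated (discrete) group $\Gamma$ is \emph{uniformly bounded (u.b.) a-T-menable} if there are a Hilbert space $H$ and an action $\alpha$ of $\Gamma$ on $H$ by affine isomorphisms such that $\|\alpha_\gamma\|\le L$ for all $\gamma\in\Gamma$ and some constant $L>0$, and such that for every bounded $B\subset H$ the set $\{\gamma\in\Gamma:\alpha_\gamma(B)\cap B\neq\emptyset\}$ is finite. \emph{u.b. fibred coarse embedding.} A metric space $(X,d)$ admits a \emph{u.b. fibred coarse embedding into Hilbert space} if there exist a separable Hilbert space $H$, a constant $L>0$, a field of Hilbert spaces $(H_x)_{x\in X}$, a section $s(x)\in H_x$, and non-decreasing functions $\rho_\pm:[0,\infty)\to\mathbb R$ with $\lim_{t\to\infty}\rho_\pm(t)=\infty$, such that for every $r>0$ there are a bounded subset $K\subset X$ and, for every $C\subset X\setminus K$ of diameter less than $r$, affine isomorphisms $t_C(x):H_x\to H$ ($x\in C$) with $\max\{\|t_C(x)\|,\|t_C(x)^{-1}\|\}\le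 L$, satisfying: (a) $\rho_-(d(x,y))\le\|t_C(x)(s(x))-t_C(y)(s(y))\|\le\rho_+(d(x,y))$ for all $x,y\in C$; (b) for any two such subsets $C_1,C_2$ with $C_1\cap C_2\ne\emptyset$ there is an affine isomorphism $t_{C_1C_2}$ of $H$ with $\max\{\|t_{C_1C_2}\|,\|t_{C_1C_2}^{-1}\|\}\le L$ and $t_{C_1}(x)\,t_{C_2}(x)^{-1}=t_{C_1C_2}$ for all $x\in C_1\cap C_2$. \emph{Warped cone.} Let $\Gamma$ be a group with a finite symmetric generating set $S$, acting by homeomorphisms on a compact metric space $(Y,d_Y)$ of diameter at most $2$. The warped cone $\mathcal O_\Gamma Y$ is the set $[1,\infty)\times Y$ equipped with the greatest metric $d_\Gamma$ such that $d_\Gamma\le d$ and $d_\Gamma(x,sx)\le 1$ for all $s\in S$ and all $x$, where $d((t,y),(t',y'))=|t-t'|+\min\{t,t'\}\,d_Y(y,y')$ and $\gamma(t,y)=(t,\gamma y)$. \emph{Properties of actions.} The action of $\Gamma$ on $Y$ is \emph{linearizable in a Hilbert space} if there are an isometric linear representation $\pi$ of $\Gamma$ on a Hilbert space $E$ and a bi-Lipschitz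 embedding $\varphi:Y\to E$ with $\varphi(\gamma y)=\pi(\gamma)\varphi(y)$ for all $\gamma\in\Gamma$ and $y\in Y$. It is \emph{essentially free} with respect to a measure $\mu$ if $\mu(\{y\in Y:\gamma y=y\text{ for some }\gamma\ne e\})=0$. \textbf{Theorem.} Let $\Gamma$ be a finitely generated group with a finite symmetric generating set $S$, acting by homeomorphisms on a compact metric space $Y$ of diameter at most $2$, and let $\mathcal O_\Gamma Y$ be the warped cone relative to $S$. \begin{enumerate} \item If the action is free and linearizable in a Hilbert space, and $\Gamma$ is u.b. a-T-menable, then $\mathcal O_\Gamma Y$ admits a u.b. fibred coarse embedding into Hilbert space. \item If there is a $\Gamma$-invariant Borel probability measure $\mu$ on $Y$ with respect to which the action is essentially free, and $\mathcal O_\Gamma Y$ admits a u.b. fibred coarse embedding into Hilbert space, then $\Gamma$ is u.b. a-T-menable. \end{enumerate} -/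

import Mathlib

open scoped NNReal

/-! ### Affine isomorphisms of Hilbert spaces

The affine isomorphisms `E → F` are Mathlib's `E ≃ᵃ[ℂ] F`; the norm of an affine map is
the operator norm of its linear part. -/

/-- `‖ψ‖ ≤ L` for an affine isomorphism `ψ` and `0 ≤ L`: the linear part of `ψ` has operator
norm at most `L`. -/
def AffineNormLE {E F : Type*} [NormedAddCommGroup E] [NormedSpace ℂ E]
    [NormedAddCommGroup F] [NormedSpace ℂ F] (L : ℝ) (ψ : E ≃ᵃ[ℂ] F) : Prop :=
  ∀ v : E, ‖ψ.linear v‖ ≤ L * ‖v‖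

/-- Uniformly bounded a-T-menability of a discrete group `Γ`: there is an affine action of `Γ`
on a Hilbert space which is uniformly bounded and metrically proper.  As `Γ` is discrete,
continuity of the action is automatic and "relatively compact" means "finite". -/
def UBATMenable.{w, u} (Γ : Type u) [Group Γ] : Prop :=
  ∃ (H : Type w) (_ : NormedAddCommGroup H) (_ : InnerProductSpace ℂ H) (_ : CompleteSpace H)
    (α : Γ →* (H ≃ᵃ[ℂ] H)),
    (∃ L : ℝ, 0 < L ∧ ∀ γ : Γ, AffineNormLE L (α γ)) ∧
    ∀ B : Set H, Bornology.IsBounded B → {γ : Γ | ((α γ '' B) ∩ B).Nonempty}.Finite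

/-- Uniformly bounded fibred coarse embeddability of a metric space `X` into Hilbert space.
`H` is the separable model space, `F` the field of Hilbert spaces over `X`, `s` the section.
Boundedness of `C` is stated next to the bound on its diameter because `Metric.diam` is `0` on
unbounded sets. -/
def HasUBFibredCoarseEmbedding.{w, u} (X : Type u) [MetricSpace X] : Prop :=
  ∃ (H : Type w) (_ : NormedAddCommGroup H) (_ : InnerProductSpace ℂ H) (_ : CompleteSpace H)
    (_ : TopologicalSpace.SeparableSpace H)
    (F : X → Type w) (_ : ∀ x, NormedAddCommGroup (F x)) (_ : ∀ x, InnerProductSpace ℂ (F x))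
    (_ : ∀ x, CompleteSpace (F x))
    (s : ∀ x, F x) (L : ℝ) (ρ₁ ρ₂ : ℝ≥0 → ℝ),
    0 < L ∧
    Monotone ρ₁ ∧ Filter.Tendsto ρ₁ Filter.atTop Filter.atTop ∧
    Monotone ρ₂ ∧ Filter.Tendsto ρ₂ Filter.atTop Filter.atTop ∧
    ∀ r : ℝ, 0 < r → ∃ K : Set X, Bornology.IsBounded K ∧
      ∃ t : ∀ C : {C : Set X // C ⊆ Kᶜ ∧ Bornology.IsBounded C ∧ Metric.diam C < r},
          ∀ x : C.1, F x ≃ᵃ[ℂ] H,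
        (∀ C x, AffineNormLE L (t C x) ∧ AffineNormLE L (t C x).symm) ∧
        (∀ C, ∀ x y : C.1,
          ρ₁ (nndist x.1 y.1) ≤ ‖t C x (s x) - t C y (s y)‖ ∧
          ‖t C x (s x) - t C y (s y)‖ ≤ ρ₂ (nndist x.1 y.1)) ∧
        (∀ C₁ C₂, (C₁.1 ∩ C₂.1).Nonempty →
          ∃ τ : H ≃ᵃ[ℂ] H, AffineNormLE L τ ∧ AffineNormLE L τ.symm ∧
            ∀ (x : X) (h₁ : x ∈ C₁.1) (h₂ : x ∈ C₂.1),
              (t C₂ ⟨x, h₂⟩).symm.trans (t C₁ ⟨x, h₁⟩) = τ)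

/-! ### Warped metrics -/

section Warped

variable {Γ X : Type*} [Group Γ] [MulAction Γ X]

/-- The distance function of a metric `m` on `X`, with `m` explicit. -/
def distOf (m : MetricSpace X) (x y : X) : ℝ :=
  @dist X m.toPseudoMetricSpace.toDist x y

/-- `m` is a metric on `X` that is dominated by the metric `d` and satisfies
`m (x, s x) ≤ 1` for all `s ∈ S`. -/
def IsWarpingCompetitor (d : MetricSpace X) (S : Set Γ) (m : MetricSpace X) : Prop :=
  (∀ x y : X, distOf m x y ≤ distOf d x y) ∧ ∀ s ∈ S, ∀ x : X, distOf m x (s • x) ≤ 1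

/-- The metric `min d 1`, which shows that there are competitors. -/
@[reducible] noncomputable def truncatedMetric (d : MetricSpace X) : MetricSpace X where
  dist x y := min (distOf d x y) 1
  dist_self x := by simp [distOf]
  dist_comm x y := by simp [distOf, dist_comm]
  dist_triangle x y z := by
    have h := dist_triangle x y z
    have h1 := @dist_nonneg _ _ x y
    have h2 := @dist_nonneg _ _ y z
    change min (dist x z) 1 ≤ min (dist x y) 1 + min (dist y z) 1
    rcases le_total (dist x y) 1 with a | a <;> rcases le_total (dist y z) 1 with b | b <;>
      simp only [a, b, min_eq_left, min_eq_right] <;>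
      first
        | exact (min_le_left _ _).trans h
        | exact (min_le_right _ _).trans (by linarith)
  eq_of_dist_eq_zero {x y} h := by
    have h : min (dist x y) 1 = 0 := h
    rcases min_choice (dist x y) 1 with a | a
    · exact dist_eq_zero.1 (a ▸ h)
    · rw [a] at h; norm_num at h

theorem truncatedMetric_competitor (d : MetricSpace X) (S : Set Γ) :
    IsWarpingCompetitor d S (truncatedMetric d) :=
  ⟨fun _ _ => min_le_left _ _, fun _ _ _ => min_le_right _ _⟩

/-- The pointwise supremum of all competitors. -/
noncomputable def warpedDist (d : MetricSpace X) (S : Set Γ) (x y : X) : ℝ :=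
  ⨆ m : {m : MetricSpace X // IsWarpingCompetitor d S m}, distOf m.1 x y

instance nonempty_warpingCompetitor (d : MetricSpace X) (S : Set Γ) :
    Nonempty {m : MetricSpace X // IsWarpingCompetitor d S m} :=
  ⟨⟨truncatedMetric d, truncatedMetric_competitor d S⟩⟩

theorem le_warpedDist {d : MetricSpace X} {S : Set Γ} {m : MetricSpace X}
    (hm : IsWarpingCompetitor d S m) (x y : X) : distOf m x y ≤ warpedDist d S x y :=
  le_ciSup (f := fun m : {m : MetricSpace X // IsWarpingCompetitor d S m} => distOf m.1 x y)
    ⟨distOf d x y, by rintro _ ⟨m, rfl⟩; exact m.2.1 x y⟩ ⟨m, hm⟩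

/-- The warped metric `d_Γ` on `X` relative to `S`; see `warpedMetricSpace_isGreatest`. -/
@[reducible] noncomputable def warpedMetricSpace (d : MetricSpace X) (S : Set Γ) :
    MetricSpace X where
  dist := warpedDist d S
  dist_self x := by
    have h : ∀ m : {m : MetricSpace X // IsWarpingCompetitor d S m}, distOf m.1 x x = 0 :=
      fun m => @dist_self X m.1.toPseudoMetricSpace x
    simp [warpedDist, h]
  dist_comm x y := by
    have h : ∀ m : {m : MetricSpace X // IsWarpingCompetitor d S m},
      distOf m.1 x y = distOf m.1 y x := fun m => @dist_comm X m.1.toPseudoMetricSpace x y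
    simp [warpedDist, h]
  dist_triangle x y z := ciSup_le fun m =>
    (@dist_triangle X m.1.toPseudoMetricSpace x y z).trans
      (add_le_add (le_warpedDist m.2 x y) (le_warpedDist m.2 y z))
  eq_of_dist_eq_zero {x y} h := by
    have h1 := le_warpedDist (truncatedMetric_competitor d S) x y
    have h2 : warpedDist d S x y = 0 := h
    rw [h2] at h1
    exact (truncatedMetric d).eq_of_dist_eq_zero
      (le_antisymm h1 (@dist_nonneg _ (truncatedMetric d).toPseudoMetricSpace x y))

/-- The warped metric is the greatest metric with `d_Γ ≤ d` and `d_Γ (x, s x) ≤ 1`, `s ∈ S`. -/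
theorem warpedMetricSpace_isGreatest (d : MetricSpace X) (S : Set Γ) :
    IsWarpingCompetitor d S (warpedMetricSpace d S) ∧
      ∀ m : MetricSpace X, IsWarpingCompetitor d S m →
        ∀ x y, distOf m x y ≤ distOf (warpedMetricSpace d S) x y :=
  ⟨⟨fun x y => ciSup_le fun m => m.2.1 x y, fun s hs x => ciSup_le fun m => m.2.2 s hs x⟩,
    fun _ hm => le_warpedDist hm⟩

end Warped

/-! ### Cones and warped cones -/

/-- The underlying set `[1, ∞) × Y` of the cone of `Y`. -/
@[ext] structure MetricCone (Y : Type*) where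
  height : ℝ
  one_le_height : 1 ≤ height
  base : Y

/-- The cone metric `|t - t'| + min t t' * d_Y (y, y')`.  The triangle inequality needs the
diameter of `Y` to be at most `2`. -/
@[reducible] noncomputable def MetricCone.metricSpace {Y : Type*} [MetricSpace Y]
    (hY : ∀ y y' : Y, dist y y' ≤ 2) : MetricSpace (MetricCone Y) where
  dist p q := |p.height - q.height| + min p.height q.height * dist p.base q.base
  dist_self p := by simp
  dist_comm p q := by rw [abs_sub_comm, min_comm, dist_comm]
  dist_triangle p q r := by
    obtain ⟨a, ha, x⟩ := p
    obtain ⟨b, hb, y⟩ := q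
    obtain ⟨c, hc, z⟩ := r
    change |a - c| + min a c * dist x z ≤
      |a - b| + min a b * dist x y + (|b - c| + min b c * dist y z)
    have h := dist_triangle x y z
    have h1 := @dist_nonneg _ _ x y
    have h2 := @dist_nonneg _ _ y z
    have h3 := hY x z
    have h4 : |a - c| ≤ |a - b| + |b - c| := abs_sub_le a b c
    rcases le_total b (min a c) with hbm | hbm
    · have hba : b ≤ a := hbm.trans (min_le_left _ _)
      have hbc : b ≤ c := hbm.trans (min_le_right _ _)
      rw [min_eq_right hba, min_eq_left hbc]
      have e1 : |a - b| = a - b := abs_of_nonneg (by linarith)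
      have e2 : |b - c| = c - b := by rw [abs_sub_comm]; exact abs_of_nonneg (by linarith)
      have e3 : |a - c| = a + c - 2 * min a c := by
        rcases le_total a c with h' | h'
        · rw [min_eq_left h', abs_sub_comm, abs_of_nonneg (by linarith)]; ring
        · rw [min_eq_right h', abs_of_nonneg (by linarith)]; ring
      rw [e1, e2, e3]
      nlinarith [mul_le_mul_of_nonneg_left h (by linarith : (0 : ℝ) ≤ b),
        mul_le_mul_of_nonneg_left h3 (by linarith : (0 : ℝ) ≤ min a c - b)]
    · have g0 : (0 : ℝ) ≤ min a c := le_min (by linarith) (by linarith)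
      have g1 : min a c ≤ min a b := le_min (min_le_left _ _) hbm
      have g2 : min a c ≤ min b c := le_min hbm (min_le_right _ _)
      nlinarith [mul_le_mul_of_nonneg_left h g0, mul_le_mul_of_nonneg_right g1 h1,
        mul_le_mul_of_nonneg_right g2 h2]
  eq_of_dist_eq_zero {p q} h := by
    have h : |p.height - q.height| + min p.height q.height * dist p.base q.base = 0 := h
    have hm : 0 < min p.height q.height :=
      lt_min (by linarith [p.one_le_height]) (by linarith [q.one_le_height])
    have h1 := abs_nonneg (p.height - q.height)
    have h2 : 0 ≤ min p.height q.height * dist p.base q.base := by positivity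
    have e1 : |p.height - q.height| = 0 := by linarith
    have e2 : min p.height q.height * dist p.base q.base = 0 := by linarith
    ext
    · linarith [abs_eq_zero.1 e1]
    · exact dist_eq_zero.1 ((mul_eq_zero.1 e2).resolve_left hm.ne')

/-- The action `γ (t, y) = (t, γ y)` on the cone. -/
instance MetricCone.mulAction {Γ Y : Type*} [Group Γ] [MulAction Γ Y] :
    MulAction Γ (MetricCone Y) where
  smul γ p := ⟨p.height, p.one_le_height, γ • p.base⟩
  one_smul p := MetricCone.ext rfl (one_smul Γ p.base)
  mul_smul γ η p := MetricCone.ext rfl (mul_smul γ η p.base)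

/-- The warped cone `𝒪_Γ Y` relative to the generating set `S` of `Γ`: the cone of `Y` with the
warped metric. -/
def WarpedCone {Γ Y : Type*} [Group Γ] [MetricSpace Y] [MulAction Γ Y] (_S : Set Γ)
    (_hY : ∀ y y' : Y, dist y y' ≤ 2) : Type _ :=
  MetricCone Y

noncomputable instance WarpedCone.instMetricSpace {Γ Y : Type*} [Group Γ] [MetricSpace Y]
    [MulAction Γ Y] (S : Set Γ) (hY : ∀ y y' : Y, dist y y' ≤ 2) :
    MetricSpace (WarpedCone S hY) :=
  warpedMetricSpace (X := MetricCone Y) (MetricCone.metricSpace hY) S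

/-! ### Properties of actions -/

/-- The action of `Γ` on `Y` is linearizable in a Hilbert space: there are an isometric linear
representation `π` of `Γ` on a Hilbert space `E` and a bi-Lipschitz equivariant embedding
`Y → E`. -/
def LinearizableInHilbert.{w, u, v} (Γ : Type u) (Y : Type v) [Group Γ] [MetricSpace Y]
    [MulAction Γ Y] : Prop :=
  ∃ (E : Type w) (_ : NormedAddCommGroup E) (_ : InnerProductSpace ℂ E) (_ : CompleteSpace E)
    (π : Γ →* (E ≃ₗᵢ[ℂ] E)) (φ : Y → E),
    (∃ K K' : ℝ≥0, LipschitzWith K φ ∧ AntilipschitzWith K' φ) ∧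
    ∀ (γ : Γ) (y : Y), φ (γ • y) = π γ (φ y)

/-- The action of `Γ` on `Y` is free. -/
def FreeAction (Γ Y : Type*) [Group Γ] [MulAction Γ Y] : Prop :=
  ∀ (γ : Γ) (y : Y), γ • y = y → γ = 1

/-- The action of `Γ` on `(Y, μ)` is essentially free. -/
def EssentiallyFreeAction (Γ : Type*) {Y : Type*} [Group Γ] [MulAction Γ Y] [MeasurableSpace Y]
    (μ : MeasureTheory.Measure Y) : Prop :=
  μ {y : Y | ∃ γ : Γ, γ ≠ 1 ∧ γ • y = y} = 0

universe u v w₁ w₂ w₃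

/-! Embedding the warped cone. Linearizability makes `(t, y) ↦ (t φ(y), t)` an equivariant
bi-Lipschitz map `Φ` of the cone into a Hilbert space on which `Γ` acts by linear isometries `π`.
Let `Γ` act by `α × π` on the sum of the two Hilbert spaces, `α` being the proper affine action, and
take `x ↦ (0, Φ x)` as section. Over a set `C` of small diameter, pick for each `x` in `C` a group
element that carries `x` near a base point of `C` at a cost controlled by the warped distance
(`exists_moveCost_lt`), and trivialize the fibre by the action of this element. Freeness and
compactness make cheap elements unique at large height (`exists_height_moveCost_lt_imp_eq_one`).
Hence the choices within `C` are compatible, and the transition between two sets is the action of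
one group element. Properness of `α` gives the lower control function (`tendsto_iInf_max_atTop`).

Recovering the affine action. Fix a radius `N` and a high level of the cone. To each `y` in `Y`
belongs the finite set of (discretized) points `γ⁻¹ y` with `γ` in the `N`-ball; trivializing the
section over this set and letting `y` vary gives vectors `b γ` in `L²(μ, H)`. Passing from `y` to
`γ⁻¹ y` changes the trivialization by a map of norm at most `L`, so invariance of `μ` bounds
combinations of `b (γ η) - b γ` by `L` times those of `b η - b 1` (`exists_level_map`). Essential
freeness and `exists_height_near_orbit` keep orbit points of a set of measure at least one half as
far apart as word length demands, which bounds `b γ - b 1` below. An ultralimit over `N`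
(`exists_hilbert_ultralimit`) removes the restriction to balls, and the kernel criterion
`UBATMenable.of_linearCombination_le` turns the limit into a proper uniformly bounded affine action.
-/

/-! ### Separable Hilbert spaces and affine actions built from kernels. -/

section HilbertSpaces

/-- Orthonormal vectors are `√2 > 1` apart, so balls of radius `1 / 2` around them are disjoint open
sets. -/
theorem Orthonormal.countable_of_separableSpace {M ι : Type*} [NormedAddCommGroup M]
    [InnerProductSpace ℂ M] [TopologicalSpace.SeparableSpace M] {v : ι → M}
    (hv : Orthonormal ℂ v) : Countable ι := by
  have h : ∀ i j, i ≠ j → 1 < dist (v i) (v j) := by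
    intro i j hij
    have h2 : ‖v i - v j‖ ^ 2 = 2 := by
      rw [@norm_sub_sq ℂ, hv.1 i, hv.1 j, hv.2 hij]
      norm_num
    rw [dist_eq_norm]
    nlinarith [norm_nonneg (v i - v j)]
  have hd : (Set.univ : Set ι).PairwiseDisjoint fun i => Metric.ball (v i) (1 / 2) := by
    intro i _ j _ hij
    exact Metric.ball_disjoint_ball (by linarith [h i j hij])
  have := hd.countable_of_isOpen (fun i _ => Metric.isOpen_ball)
    (fun i _ => ⟨v i, Metric.mem_ball_self (by norm_num)⟩)
  exact Set.countable_univ_iff.1 this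

/-- A separable Hilbert space has an isometric copy in every universe. -/
theorem exists_linearIsometryEquiv_universe.{w, a} (M : Type a) [NormedAddCommGroup M]
    [InnerProductSpace ℂ M] [CompleteSpace M] [TopologicalSpace.SeparableSpace M] :
    ∃ (H : Type w) (_ : NormedAddCommGroup H) (_ : InnerProductSpace ℂ H) (_ : CompleteSpace H)
      (_ : TopologicalSpace.SeparableSpace H), Nonempty (M ≃ₗᵢ[ℂ] H) := by
  obtain ⟨s, b, -⟩ := exists_hilbertBasis ℂ M
  have hs : Countable s := b.orthonormal.countable_of_separableSpace
  -- A countable index set is small in every universe, so the Hilbert basis can be reindexed there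
  -- and the space replaced by `ℓ²`.
  let e : Shrink.{w, a} s ≃ s := (equivShrink.{w, a} s).symm
  have hr : Set.range (b ∘ e) = Set.range b := e.surjective.range_comp b
  let b' : HilbertBasis (Shrink.{w, a} s) ℂ M :=
    HilbertBasis.mk (b.orthonormal.comp e e.injective) (by rw [hr, b.dense_span])
  exact ⟨lp (fun _ : Shrink.{w, a} s => ℂ) 2, inferInstance, inferInstance, inferInstance,
    b'.repr.surjective.denseRange.separableSpace b'.repr.continuous, ⟨b'.repr⟩⟩

/-- An affine action from its linear parts and translation parts. -/
theorem exists_affineAction_of_cocycle {Γ H : Type*} [Group Γ] [NormedAddCommGroup H]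
    [InnerProductSpace ℂ H] (π : Γ → (H →L[ℂ] H)) (c : Γ → H) (h_one : ∀ v, π 1 v = v)
    (h_mul : ∀ γ η v, π (γ * η) v = π γ (π η v)) (hc_one : c 1 = 0)
    (hc_mul : ∀ γ η, c (γ * η) = π γ (c η) + c γ) :
    ∃ α : Γ →* (H ≃ᵃ[ℂ] H), (∀ γ v, α γ v = π γ v + c γ) ∧ ∀ γ v, (α γ).linear v = π γ v := by
  let A : Γ →* (H →ᵃ[ℂ] H) :=
    { toFun := fun γ => ((π γ : H →ₗ[ℂ] H)).toAffineMap + AffineMap.const ℂ H (c γ)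
      map_one' := by
        ext v
        simp [h_one, hc_one]
      map_mul' := by
        intro γ η
        ext v
        simp [h_mul, hc_mul, add_assoc] }
  -- A monoid homomorphism from a group takes values in the units, so no inverses have to be
  -- constructed.
  refine ⟨(AffineEquiv.equivUnitsAffineMap (k := ℂ) (P₁ := H)).symm.toMonoidHom.comp A.toHomUnits,
    ?_, ?_⟩
  · intro γ v
    rfl
  · intro γ v
    change (A γ).linear v = _
    simp [A]

/-- A kernel-type criterion for the existence of a uniformly bounded affine action. -/
theorem exists_affineAction_of_linearCombination_le.{w, u₁, u₂, u₃} {Γ : Type u₁} {P : Type u₂}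
    {H : Type u₃} [Group Γ] [MulAction Γ P] [NormedAddCommGroup H] [InnerProductSpace ℂ H]
    [CompleteSpace H] (b : P → H) (hb : TopologicalSpace.IsSeparable (Set.range b)) (p₀ : P)
    (L : ℝ)
    (hL : ∀ (γ : Γ) (v : P →₀ ℂ),
      ‖Finsupp.linearCombination ℂ (fun p => b (γ • p) - b (γ • p₀)) v‖ ≤
        L * ‖Finsupp.linearCombination ℂ (fun p => b p - b p₀) v‖) :
    ∃ (H' : Type w) (_ : NormedAddCommGroup H') (_ : InnerProductSpace ℂ H')
      (_ : CompleteSpace H') (_ : TopologicalSpace.SeparableSpace H')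
      (α : Γ →* (H' ≃ᵃ[ℂ] H')) (b' : P → H'),
      (∀ γ, AffineNormLE L (α γ)) ∧ (∀ γ p, α γ (b' p) = b' (γ • p)) ∧
        ∀ p q, ‖b' p - b' q‖ = ‖b p - b q‖ := by
  let W : Submodule ℂ H := Submodule.span ℂ (Set.range fun p => b p - b p₀)
  let M : Submodule ℂ H := W.topologicalClosure
  have hsep : TopologicalSpace.IsSeparable (Set.range fun p => b p - b p₀) := by
    have : (Set.range fun p => b p - b p₀) = (fun x => x - b p₀) '' Set.range b := by
      rw [← Set.range_comp]; rfl
    rw [this]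
    exact hb.image (by fun_prop)
  have hsepM : TopologicalSpace.SeparableSpace M := (hsep.span (R := ℂ)).closure.separableSpace
  have hMc : IsClosed (M : Set H) := W.isClosed_topologicalClosure
  have : CompleteSpace M := hMc.completeSpace_coe
  obtain ⟨H', i1, i2, i3, i4, ⟨J⟩⟩ := exists_linearIsometryEquiv_universe.{w} M
  have hmem : ∀ p, b p - b p₀ ∈ M := fun p =>
    W.le_topologicalClosure (Submodule.subset_span ⟨p, rfl⟩)
  let b' : P → H' := fun p => J ⟨b p - b p₀, hmem p⟩
  have hJ : ∀ (w : P → M) (v : P →₀ ℂ),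
      ‖Finsupp.linearCombination ℂ (fun p => J (w p)) v‖ =
        ‖Finsupp.linearCombination ℂ (fun p => (w p : H)) v‖ := by
    intro w v
    have h1 : Finsupp.linearCombination ℂ (fun p => J (w p)) v =
        J (Finsupp.linearCombination ℂ w v) := by
      simp only [Finsupp.linearCombination_apply, Finsupp.sum, map_sum, map_smul]
    have h2 : ((Finsupp.linearCombination ℂ w v : M) : H) =
        Finsupp.linearCombination ℂ (fun p => (w p : H)) v := by
      simp [Finsupp.linearCombination_apply, Finsupp.sum]
    rw [h1, J.norm_map, ← h2]
    rfl
  have hb' : ∀ p q, ‖b' p - b' q‖ = ‖b p - b q‖ := by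
    intro p q
    rw [← map_sub, J.norm_map, ← sub_sub_sub_cancel_right (b p) (b q) (b p₀)]
    rfl
  have hb'0 : b' p₀ = 0 := by
    have := hb' p₀ p₀
    simp only [b', sub_self]
    exact J.map_zero
  let e : (P →₀ ℂ) →ₗ[ℂ] H' := Finsupp.linearCombination ℂ b'
  have he : DenseRange e := by
    refine Metric.dense_iff.2 fun x r hr => ?_
    obtain ⟨y, rfl⟩ := J.surjective x
    obtain ⟨w, hw, hyw⟩ := Metric.mem_closure_iff.1 (show (y : H) ∈ closure (W : Set H) from y.2) r hr
    obtain ⟨v, rfl⟩ := Finsupp.mem_span_range_iff_exists_finsupp.1 hw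
    refine ⟨e v, ?_, v, rfl⟩
    have h1 : e v = J (Finsupp.linearCombination ℂ (fun p => (⟨b p - b p₀, hmem p⟩ : M)) v) := by
      simp only [Finsupp.linearCombination_apply, Finsupp.sum, map_sum, map_smul, e, b']
    rw [Metric.mem_ball, dist_comm, h1, J.dist_map, Subtype.dist_eq]
    simpa [Finsupp.linearCombination_apply, Finsupp.sum] using hyw
  -- The prescribed linear part of `γ`, still on formal combinations. The bound `hL` makes it
  -- descend along `e` and extend continuously from the dense range of `e`.
  let f : Γ → (P →₀ ℂ) →ₗ[ℂ] H' := fun γ =>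
    Finsupp.linearCombination ℂ (fun p => b' (γ • p) - b' (γ • p₀))
  have hf : ∀ γ v, ‖f γ v‖ ≤ L * ‖e v‖ := by
    intro γ v
    have h1 : (fun p => b' (γ • p) - b' (γ • p₀)) =
        fun p => J (⟨b (γ • p) - b p₀, hmem _⟩ - ⟨b (γ • p₀) - b p₀, hmem _⟩) := by
      ext p
      rw [map_sub]
    have h2 := hL γ v
    simp only [f, e, h1, b', hJ]
    simpa using h2
  let π : Γ → (H' →L[ℂ] H') := fun γ => (f γ).extendOfNorm e
  have hπ : ∀ γ p, π γ (b' p) = b' (γ • p) - b' (γ • p₀) := by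
    intro γ p
    have := LinearMap.extendOfNorm_eq (f := f γ) he ⟨L, hf γ⟩ (Finsupp.single p 1)
    simpa [e, f] using this
  have hext : ∀ T₁ T₂ : H' →L[ℂ] H', (∀ p, T₁ (b' p) = T₂ (b' p)) → ∀ v, T₁ v = T₂ v := by
    intro T₁ T₂ h v
    have : (T₁ : H' → H') = T₂ := by
      refine he.equalizer T₁.continuous T₂.continuous ?_
      ext v
      simp [e, Finsupp.linearCombination_apply, Finsupp.sum, h]
    rw [this]
  -- Since `b' p₀ = 0`, the translation part has to be the image of the origin, `b' (γ • p₀)`.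
  obtain ⟨α, hα, hαl⟩ := exists_affineAction_of_cocycle π (fun γ => b' (γ • p₀))
    (hext (π 1) (ContinuousLinearMap.id ℂ H') (by simp [hπ, hb'0]))
    (fun γ η => hext (π (γ * η)) ((π γ).comp (π η)) (by simp [hπ, mul_smul]))
    (by simp [hb'0]) (by simp [hπ, mul_smul])
  refine ⟨H', i1, i2, i3, i4, α, b', ?_, ?_, hb'⟩
  · intro γ v
    rw [hαl]
    exact LinearMap.norm_extendOfNorm_apply_le he L (hf γ) v
  · intro γ p
    rw [hα, hπ, sub_add_cancel]

end HilbertSpaces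

/-! ### Ultralimits of Hilbert space valued maps. -/

section Ultralimit

open Filter Topology

/-- An ultralimit of linear maps into Hilbert spaces. -/
theorem exists_hilbert_ultralimit.{a, c} {V : Type a} [AddCommGroup V] [Module ℂ V]
    (ω : Ultrafilter ℕ) (E : ℕ → Type c) [∀ n, NormedAddCommGroup (E n)]
    [∀ n, InnerProductSpace ℂ (E n)] (T : ∀ n, V →ₗ[ℂ] E n)
    (hT : ∀ v, ∃ C : ℝ, ∀ᶠ n in (ω : Filter ℕ), ‖T n v‖ ≤ C) :
    ∃ (H : Type a) (_ : NormedAddCommGroup H) (_ : InnerProductSpace ℂ H) (_ : CompleteSpace H)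
      (U : V →ₗ[ℂ] H), ∀ v, Tendsto (fun n => ‖T n v‖) ω (𝓝 ‖U v‖) := by
  -- By Cauchy–Schwarz the inner products stay in a compact disc along `ω`, hence converge.
  have hlim : ∀ v w, ∃ z : ℂ, Tendsto (fun n => inner ℂ (T n v) (T n w)) ω (𝓝 z) := by
    intro v w
    obtain ⟨C, hC⟩ := hT v
    obtain ⟨D, hD⟩ := hT w
    have hb : ∀ᶠ n in (ω : Filter ℕ),
        inner ℂ (T n v) (T n w) ∈ Metric.closedBall (0 : ℂ) (C * D) := by
      filter_upwards [hC, hD] with n h1 h2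
      rw [mem_closedBall_zero_iff]
      exact (norm_inner_le_norm _ _).trans
        (mul_le_mul h1 h2 (norm_nonneg _) ((norm_nonneg _).trans h1))
    obtain ⟨z, -, hz⟩ := (isCompact_closedBall (0 : ℂ) (C * D)).ultrafilter_le_nhds
      (ω.map fun n => inner ℂ (T n v) (T n w)) (le_principal_iff.2 hb)
    exact ⟨z, hz⟩
  choose k hk using hlim
  let core : PreInnerProductSpace.Core ℂ V :=
    { inner := k
      conj_inner_symm := by
        intro x y
        refine tendsto_nhds_unique ((Complex.continuous_conj.tendsto _).comp (hk y x)) ?_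
        simpa [Function.comp_def] using hk x y
      re_inner_nonneg := by
        intro x
        refine ge_of_tendsto' ((Complex.continuous_re.tendsto _).comp (hk x x)) fun n => ?_
        exact inner_self_nonneg (𝕜 := ℂ)
      add_left := by
        intro x y z
        refine tendsto_nhds_unique (hk (x + y) z) ?_
        simpa [inner_add_left] using (hk x z).add (hk y z)
      smul_left := by
        intro x y r
        refine tendsto_nhds_unique (hk (r • x) y) ?_
        simpa [inner_smul_left, mul_comm] using (hk x y).const_mul ((starRingEnd ℂ) r) }
  let _ : SeminormedAddCommGroup V := InnerProductSpace.Core.toSeminormedAddCommGroup (c := core)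
  let _ : InnerProductSpace ℂ V := InnerProductSpace.ofCore core
  -- The limit form is only semidefinite; the Hausdorff completion also divides out its null
  -- vectors.
  refine ⟨UniformSpace.Completion V, inferInstance, inferInstance, inferInstance,
    (UniformSpace.Completion.toComplL (𝕜 := ℂ) (E := V)).toLinearMap, fun v => ?_⟩
  have h1 : ‖(UniformSpace.Completion.toComplL (𝕜 := ℂ) (E := V)).toLinearMap v‖ =
      √(k v v).re := by
    change ‖(v : UniformSpace.Completion V)‖ = _
    rw [UniformSpace.Completion.norm_coe]
    rfl
  rw [h1]
  have h2 := (Real.continuous_sqrt.tendsto _).comp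
    ((Complex.continuous_re.tendsto _).comp (hk v v))
  refine h2.congr fun n => ?_
  simp only [Function.comp_apply]
  rw [show (inner ℂ (T n v) (T n v)).re = ‖T n v‖ ^ 2 from
    (norm_sq_eq_re_inner (𝕜 := ℂ) (T n v)).symm]
  exact Real.sqrt_sq (norm_nonneg _)

end Ultralimit

/-! ### A criterion for uniformly bounded a-T-menability. -/

section Menable

theorem AffineNormLE.norm_sub_le {E F : Type*} [NormedAddCommGroup E] [NormedSpace ℂ E]
    [NormedAddCommGroup F] [NormedSpace ℂ F] {L : ℝ} {ψ : E ≃ᵃ[ℂ] F} (h : AffineNormLE L ψ)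
    (x y : E) : ‖ψ x - ψ y‖ ≤ L * ‖x - y‖ := by
  have := ψ.toAffineMap.linearMap_vsub x y
  simp only [vsub_eq_sub] at this
  have h2 := h (x - y)
  have h3 : ψ.linear (x - y) = ψ x - ψ y := this
  rwa [h3] at h2

theorem AffineNormLE.mono {E F : Type*} [NormedAddCommGroup E] [NormedSpace ℂ E]
    [NormedAddCommGroup F] [NormedSpace ℂ F] {L L' : ℝ} {ψ : E ≃ᵃ[ℂ] F} (h : AffineNormLE L ψ)
    (hL : L ≤ L') : AffineNormLE L' ψ :=
  fun v => (h v).trans (mul_le_mul_of_nonneg_right hL (norm_nonneg v))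

/-- A kernel-type criterion for uniformly bounded a-T-menability. -/
theorem UBATMenable.of_linearCombination_le.{w, g, a} {Γ : Type g} [Group Γ] [Countable Γ]
    {H : Type a} [NormedAddCommGroup H] [InnerProductSpace ℂ H] [CompleteSpace H] (b : Γ → H)
    (L : ℝ)
    (hL : ∀ (γ : Γ) (v : Γ →₀ ℂ),
      ‖Finsupp.linearCombination ℂ (fun η => b (γ * η) - b γ) v‖ ≤
        L * ‖Finsupp.linearCombination ℂ (fun η => b η - b 1) v‖)
    (hfin : ∀ R : ℝ, {γ : Γ | ‖b γ - b 1‖ ≤ R}.Finite) : UBATMenable.{w} Γ := by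
  obtain ⟨H', i1, i2, i3, -, α, b', hα, hαb, hb'⟩ :=
    exists_affineAction_of_linearCombination_le.{w} (Γ := Γ) b
      (Set.countable_range b).isSeparable 1 L (by simpa using hL)
  have hα' : ∀ γ, AffineNormLE (max L 1) (α γ) := fun γ => (hα γ).mono (le_max_left _ _)
  refine ⟨H', i1, i2, i3, α, ⟨max L 1, by positivity, hα'⟩, fun B hB => ?_⟩
  obtain ⟨R, hR⟩ := hB.subset_closedBall (b' 1)
  refine (hfin (max L 1 * R + R)).subset ?_
  rintro γ ⟨_, ⟨x, hx, rfl⟩, hx'⟩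
  have h1 := hR hx
  have h2 := hR hx'
  rw [Metric.mem_closedBall, dist_eq_norm] at h1 h2
  have h3 := (hα' γ).norm_sub_le (b' 1) x
  rw [hαb, smul_eq_mul, mul_one, norm_sub_rev (b' 1)] at h3
  rw [Set.mem_ofPred_eq, ← hb']
  -- If `x` and `α γ x` lie within `R` of `b' 1`, then `α γ (b' 1) = b' γ` is within `max L 1 * R`
  -- of `α γ x`.
  calc ‖b' γ - b' 1‖ ≤ ‖b' γ - α γ x‖ + ‖α γ x - b' 1‖ := norm_sub_le_norm_sub_add_norm_sub _ _ _
    _ ≤ max L 1 * R + R := by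
      gcongr
      exact h3.trans (by gcongr)

end Menable

/-! ### Word length on a finitely generated group. -/

section WordLength

open scoped Pointwise

variable {Γ : Type*} [Group Γ]

/-- The ball of radius `n` of `Γ` with respect to the generating set `S`. -/
def wordBall (S : Set Γ) (n : ℕ) : Set Γ := (insert 1 S) ^ n

variable {S : Set Γ}

theorem wordBall_finite (hS : S.Finite) (n : ℕ) : (wordBall S n).Finite := by
  induction n with
  | zero => simp [wordBall]
  | succ n ih =>
    rw [wordBall, pow_succ]
    exact Set.Finite.mul ih (hS.insert 1)

theorem wordBall_zero : wordBall S 0 = {1} :=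
  (pow_zero _).trans Set.singleton_one.symm

theorem exists_of_mem_wordBall_succ {n : ℕ} {γ : Γ} (h : γ ∈ wordBall S (n + 1)) :
    ∃ s ∈ insert 1 S, ∃ η ∈ wordBall S n, s * η = γ := by
  rw [wordBall, pow_succ'] at h
  exact h

theorem wordBall_mul {m n : ℕ} {γ η : Γ} (hγ : γ ∈ wordBall S m) (hη : η ∈ wordBall S n) :
    γ * η ∈ wordBall S (m + n) := by
  rw [wordBall, pow_add]
  exact Set.mul_mem_mul hγ hη

theorem wordBall_mono {m n : ℕ} (h : m ≤ n) : wordBall S m ⊆ wordBall S n :=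
  Set.pow_subset_pow_right (Set.mem_insert 1 S) h

theorem wordBall_inv (hS : ∀ s ∈ S, s⁻¹ ∈ S) {n : ℕ} {γ : Γ} (h : γ ∈ wordBall S n) :
    γ⁻¹ ∈ wordBall S n := by
  have h1 : (insert 1 S : Set Γ)⁻¹ = insert 1 S := by
    ext s
    simp only [Set.mem_inv, Set.mem_insert_iff, inv_eq_one]
    exact or_congr_right ⟨fun h => by simpa using hS _ h, hS s⟩
  have h2 : (wordBall S n)⁻¹ = wordBall S n := by
    rw [wordBall, ← inv_pow, h1]
  rw [← h2]
  simpa using h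

theorem exists_mem_wordBall (hS : ∀ s ∈ S, s⁻¹ ∈ S) (hgen : Subgroup.closure S = ⊤) (γ : Γ) :
    ∃ n, γ ∈ wordBall S n := by
  have h : γ ∈ Subgroup.closure S := by rw [hgen]; trivial
  induction h using Subgroup.closure_induction with
  | mem s hs => exact ⟨1, by simp [wordBall, hs]⟩
  | one => exact ⟨0, by simp [wordBall]⟩
  | mul x y _ _ hx hy =>
    obtain ⟨m, hm⟩ := hx
    obtain ⟨n, hn⟩ := hy
    exact ⟨m + n, wordBall_mul hm hn⟩
  | inv x _ hx =>
    obtain ⟨m, hm⟩ := hx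
    exact ⟨m, wordBall_inv hS hm⟩

/-- The word length of `γ` with respect to the generating set `S`. -/
noncomputable def wordLength (S : Set Γ) (γ : Γ) : ℕ := sInf {n | γ ∈ wordBall S n}

theorem mem_wordBall_wordLength (hS : ∀ s ∈ S, s⁻¹ ∈ S) (hgen : Subgroup.closure S = ⊤) (γ : Γ) :
    γ ∈ wordBall S (wordLength S γ) :=
  Nat.sInf_mem (s := {n | γ ∈ wordBall S n}) (exists_mem_wordBall hS hgen γ)

theorem wordLength_le {n : ℕ} {γ : Γ} (h : γ ∈ wordBall S n) : wordLength S γ ≤ n :=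
  Nat.sInf_le (s := {n | γ ∈ wordBall S n}) h

theorem wordLength_one : wordLength S (1 : Γ) = 0 :=
  Nat.le_zero.1 (wordLength_le (by simp [wordBall]))

theorem wordLength_le_one {s : Γ} (hs : s ∈ S) : wordLength S s ≤ 1 :=
  wordLength_le (by rw [wordBall, pow_one]; exact Set.mem_insert_of_mem 1 hs)

theorem wordLength_mul_le (hS : ∀ s ∈ S, s⁻¹ ∈ S) (hgen : Subgroup.closure S = ⊤) (γ η : Γ) :
    wordLength S (γ * η) ≤ wordLength S γ + wordLength S η :=
  wordLength_le (wordBall_mul (mem_wordBall_wordLength hS hgen γ)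
    (mem_wordBall_wordLength hS hgen η))

theorem wordLength_inv (hS : ∀ s ∈ S, s⁻¹ ∈ S) (hgen : Subgroup.closure S = ⊤) (γ : Γ) :
    wordLength S γ⁻¹ = wordLength S γ := by
  have h : ∀ γ : Γ, wordLength S γ⁻¹ ≤ wordLength S γ := fun γ =>
    wordLength_le (wordBall_inv hS (mem_wordBall_wordLength hS hgen γ))
  exact le_antisymm (h γ) (by simpa using h γ⁻¹)

theorem finite_wordLength_le (hfin : S.Finite) (hS : ∀ s ∈ S, s⁻¹ ∈ S)
    (hgen : Subgroup.closure S = ⊤) (n : ℕ) : {γ : Γ | wordLength S γ ≤ n}.Finite :=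
  (wordBall_finite hfin n).subset fun γ h =>
    wordBall_mono h (mem_wordBall_wordLength hS hgen γ)

theorem countable_of_finite_generating (hfin : S.Finite) (hS : ∀ s ∈ S, s⁻¹ ∈ S)
    (hgen : Subgroup.closure S = ⊤) : Countable Γ := by
  have h : (Set.univ : Set Γ) = ⋃ n, wordBall S n := by
    ext γ
    simpa using exists_mem_wordBall hS hgen γ
  rw [← Set.countable_univ_iff, h]
  exact Set.countable_iUnion fun n => (wordBall_finite hfin n).countable

end WordLength

/-! ### Bounds for the warped metric. -/

section WarpedDistance

/-- Every pseudometric that satisfies the defining inequalities is dominated by the warped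
metric. -/
theorem le_warpedDist_of_pseudometric {Γ X : Type*} [Group Γ] [MulAction Γ X] (d : MetricSpace X)
    (S : Set Γ) (f : X → X → ℝ) (h_self : ∀ x, f x x = 0) (h_symm : ∀ x y, f x y = f y x)
    (h_tri : ∀ x y z, f x z ≤ f x y + f y z) (h_le : ∀ x y, f x y ≤ distOf d x y)
    (h_gen : ∀ s ∈ S, ∀ x, f x (s • x) ≤ 1) (x y : X) : f x y ≤ warpedDist d S x y := by
  let τ := truncatedMetric d
  -- Taking the maximum with the truncated metric separates points, so the pseudometric lies below a
  -- genuine competitor.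
  let m : MetricSpace X :=
    { dist := fun x y => max (f x y) (distOf τ x y)
      dist_self := fun x => by
        have : distOf τ x x = 0 := @dist_self X τ.toPseudoMetricSpace x
        simp [h_self, this]
      dist_comm := fun x y => by
        have : distOf τ x y = distOf τ y x := @dist_comm X τ.toPseudoMetricSpace x y
        rw [this, h_symm]
      dist_triangle := fun x y z =>
        max_le ((h_tri x y z).trans (add_le_add (le_max_left _ _) (le_max_left _ _)))
          ((@dist_triangle X τ.toPseudoMetricSpace x y z).trans
            (add_le_add (le_max_right _ _) (le_max_right _ _)))
      eq_of_dist_eq_zero := fun {x y} h => by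
        have h0 : max (f x y) (distOf τ x y) = 0 := h
        exact τ.eq_of_dist_eq_zero (le_antisymm ((le_max_right _ _).trans h0.le)
          (@dist_nonneg X τ.toPseudoMetricSpace x y)) }
  have hτ := truncatedMetric_competitor d S
  exact (le_max_left _ _).trans (le_warpedDist (m := m)
    ⟨fun x y => max_le (h_le x y) (hτ.1 x y), fun s hs x => max_le (h_gen s hs x) (hτ.2 s hs x)⟩
    x y)

variable {Γ Y : Type*} [Group Γ] [MetricSpace Y] [MulAction Γ Y] {S : Set Γ}
  {hY : ∀ y y' : Y, dist y y' ≤ 2}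

/-- The height of a point of the warped cone. -/
def WarpedCone.height (x : WarpedCone S hY) : ℝ := MetricCone.height x

/-- The base point in `Y` of a point of the warped cone. -/
def WarpedCone.base (x : WarpedCone S hY) : Y := MetricCone.base x

theorem WarpedCone.one_le_height (x : WarpedCone S hY) : 1 ≤ x.height :=
  MetricCone.one_le_height x

instance WarpedCone.instMulAction : MulAction Γ (WarpedCone S hY) :=
  inferInstanceAs (MulAction Γ (MetricCone Y))

@[simp]
theorem WarpedCone.height_smul (γ : Γ) (x : WarpedCone S hY) : (γ • x).height = x.height := rfl

@[simp]
theorem WarpedCone.base_smul (γ : Γ) (x : WarpedCone S hY) : (γ • x).base = γ • x.base := rfl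

/-- The cone metric on the points of the warped cone. -/
noncomputable def WarpedCone.coneDist (x x' : WarpedCone S hY) : ℝ :=
  |x.height - x'.height| + min x.height x'.height * dist x.base x'.base

theorem WarpedCone.dist_le (x x' : WarpedCone S hY) : dist x x' ≤ x.coneDist x' :=
  (warpedMetricSpace_isGreatest (X := MetricCone Y) (MetricCone.metricSpace hY) S).1.1 x x'

/-- The source of every lower bound on the warped distance below: for heights, for transport costs
and for distances along orbits. -/
theorem WarpedCone.le_dist (f : WarpedCone S hY → WarpedCone S hY → ℝ) (h_self : ∀ x, f x x = 0)
    (h_symm : ∀ x y, f x y = f y x) (h_tri : ∀ x y z, f x z ≤ f x y + f y z)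
    (h_le : ∀ x y, f x y ≤ x.coneDist y)
    (h_gen : ∀ s ∈ S, ∀ x, f x (s • x) ≤ 1) (x y : WarpedCone S hY) : f x y ≤ dist x y :=
  le_warpedDist_of_pseudometric (MetricCone.metricSpace hY) S f h_self h_symm h_tri h_le h_gen x y

theorem WarpedCone.abs_height_sub_le (x y : WarpedCone S hY) :
    |x.height - y.height| ≤ dist x y := by
  refine WarpedCone.le_dist (fun x y => |x.height - y.height|) (by simp)
    (fun x y => abs_sub_comm _ _) (fun x y z => abs_sub_le _ _ _) (fun x y => ?_)
    (fun s _ x => ?_) x y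
  · have := x.one_le_height
    have := y.one_le_height
    exact le_add_of_nonneg_right (by positivity)
  · simp

theorem WarpedCone.dist_smul_le (hS : ∀ s ∈ S, s⁻¹ ∈ S) (hgen : Subgroup.closure S = ⊤) (γ : Γ)
    (x : WarpedCone S hY) : dist x (γ • x) ≤ wordLength S γ := by
  have h : ∀ (n : ℕ) (γ : Γ), γ ∈ wordBall S n → dist x (γ • x) ≤ n := by
    intro n
    induction n with
    | zero =>
      intro γ hγ
      obtain rfl : γ = 1 := by simpa [wordBall_zero] using hγ
      simp [one_smul]
    | succ n ih =>
      intro γ hγ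
      obtain ⟨s, hs, η, hη, rfl⟩ := exists_of_mem_wordBall_succ hγ
      have h1 := ih η hη
      have h3 : dist (η • x) (s • η • x) ≤ 1 := by
        rcases hs with rfl | hs
        · simp [one_smul]
        · exact (warpedMetricSpace_isGreatest (X := MetricCone Y)
            (MetricCone.metricSpace hY) S).1.2 s hs _
      rw [mul_smul]
      push_cast
      exact (dist_triangle _ _ _).trans (add_le_add h1 h3)
  exact h _ γ (mem_wordBall_wordLength hS hgen γ)

theorem WarpedCone.isBounded_height_le (t : ℝ) :
    Bornology.IsBounded {x : WarpedCone S hY | x.height ≤ t} := by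
  refine Metric.isBounded_iff.2 ⟨t + t * 2, fun x hx y hy => (WarpedCone.dist_le x y).trans ?_⟩
  have h1 := WarpedCone.one_le_height x
  have h2 := WarpedCone.one_le_height y
  have h3 : x.height ≤ t := hx
  have h4 : y.height ≤ t := hy
  unfold WarpedCone.coneDist
  gcongr
  · exact abs_le.2 ⟨by linarith, by linarith⟩
  · linarith
  · exact min_le_of_left_le h3
  · exact hY _ _

end WarpedDistance

/-! ### The equivariant bi-Lipschitz embedding of the cone. -/

section ConeEmbedding

variable {Γ Y : Type*} [Group Γ] [MetricSpace Y] [MulAction Γ Y] {S : Set Γ}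
  {hY : ∀ y y' : Y, dist y y' ≤ 2}

/-- Both bounds come from writing the difference as `min a b • (u - v) + (a - b) • w`, where `w` is
the vector with the larger coefficient. -/
theorem norm_smul_sub_smul_le {E : Type*} [NormedAddCommGroup E] [NormedSpace ℂ E] {a b B : ℝ}
    (ha : 0 ≤ a) (hb : 0 ≤ b) {u v : E} (hu : ‖u‖ ≤ B) (hv : ‖v‖ ≤ B) :
    ‖(a : ℂ) • u - (b : ℂ) • v‖ ≤ min a b * ‖u - v‖ + |a - b| * B ∧
      min a b * ‖u - v‖ ≤ ‖(a : ℂ) • u - (b : ℂ) • v‖ + |a - b| * B := by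
  have key : ∃ w : E, ‖w‖ ≤ B ∧
      (a : ℂ) • u - (b : ℂ) • v = ((min a b : ℝ) : ℂ) • (u - v) + ((a - b : ℝ) : ℂ) • w := by
    rcases le_total a b with h | h
    · refine ⟨v, hv, ?_⟩
      rw [min_eq_left h]
      push_cast
      module
    · refine ⟨u, hu, ?_⟩
      rw [min_eq_right h]
      push_cast
      module
  obtain ⟨w, hw, h⟩ := key
  have h1 : ‖((min a b : ℝ) : ℂ) • (u - v)‖ = min a b * ‖u - v‖ := by
    rw [norm_smul, Complex.norm_real, Real.norm_of_nonneg (le_min ha hb)]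
  have h2 : ‖((a - b : ℝ) : ℂ) • w‖ ≤ |a - b| * B := by
    rw [norm_smul, Complex.norm_real, Real.norm_eq_abs]
    gcongr
  rw [h, ← h1]
  exact ⟨(norm_add_le _ _).trans (by gcongr),
    (norm_le_norm_add_norm_sub' _ _).trans (by
      rw [sub_add_cancel_left, norm_neg]; gcongr)⟩

/-- A linearizable action yields an equivariant bi-Lipschitz embedding of the cone. -/
theorem LinearizableInHilbert.exists_cone_embedding.{w} [CompactSpace Y] (S : Set Γ)
    (hY : ∀ y y' : Y, dist y y' ≤ 2) (h : LinearizableInHilbert.{w} Γ Y) :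
    ∃ (E : Type w) (_ : NormedAddCommGroup E) (_ : InnerProductSpace ℂ E) (_ : CompleteSpace E)
      (π : Γ → (E →ₗᵢ[ℂ] E)) (Φ : WarpedCone S hY → E) (A : ℝ), 1 ≤ A ∧
      (∀ γ x, Φ (γ • x) = π γ (Φ x)) ∧ (∀ x x', ‖Φ x - Φ x'‖ ≤ A * x.coneDist x') ∧
      (∀ x x', x.coneDist x' ≤ A * ‖Φ x - Φ x'‖) ∧
      TopologicalSpace.IsSeparable (Set.range Φ) := by
  obtain ⟨E, i1, i2, i3, π, φ, ⟨K, K', hK, hK'⟩, hπ⟩ := h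
  obtain ⟨B, hB⟩ := isCompact_univ.exists_bound_of_continuousOn hK.continuous.continuousOn
  have hB : ∀ y, ‖φ y‖ ≤ max B 0 := fun y => (hB y trivial).trans (le_max_left _ _)
  have hB0 : 0 ≤ max B 0 := le_max_right _ _
  set B' := max B 0
  let π' : Γ → (WithLp 2 (E × ℂ) →ₗᵢ[ℂ] WithLp 2 (E × ℂ)) := fun γ =>
    { toFun := fun z => WithLp.toLp 2 (π γ z.fst, z.snd)
      map_add' := fun z w => by
        refine (WithLp.ofLp_injective 2) (Prod.ext ?_ ?_) <;> simp
      map_smul' := fun c z => by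
        refine (WithLp.ofLp_injective 2) (Prod.ext ?_ ?_) <;> simp
      norm_map' := fun z => by
        have : ‖WithLp.toLp 2 (π γ z.fst, z.snd)‖ ^ 2 = ‖z‖ ^ 2 := by
          simp [WithLp.prod_norm_sq_eq_of_L2]
        exact (sq_eq_sq₀ (norm_nonneg _) (norm_nonneg _)).1 this }
  -- The additional coordinate records the height, which `t φ(y)` alone need not determine.
  let Ψ : ℝ × Y → WithLp 2 (E × ℂ) := fun q => WithLp.toLp 2 ((q.1 : ℂ) • φ q.2, (q.1 : ℂ))
  let Φ : WarpedCone S hY → WithLp 2 (E × ℂ) := fun x =>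
    Ψ (x.height, x.base)
  have hΨ : Continuous Ψ := by
    have := hK.continuous
    fun_prop
  have hΦsq : ∀ x x', ‖Φ x - Φ x'‖ ^ 2 =
      ‖(x.height : ℂ) • φ x.base -
        (x'.height : ℂ) • φ x'.base‖ ^ 2 +
      |x.height - x'.height| ^ 2 := by
    intro x x'
    rw [WithLp.prod_norm_sq_eq_of_L2]
    simp only [Φ, Ψ, WithLp.sub_fst, WithLp.sub_snd]
    rw [← Real.norm_eq_abs, ← Complex.norm_real, Complex.ofReal_sub]
    rfl
  have h0 : ∀ x : WarpedCone S hY, 0 ≤ x.height := fun x => zero_le_one.trans x.one_le_height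
  have hle : ∀ x x' : WarpedCone S hY,
      ‖(x.height : ℂ) • φ x.base -
        (x'.height : ℂ) • φ x'.base‖ ≤
      min x.height x'.height * ‖φ x.base - φ x'.base‖ + |x.height - x'.height| * B' :=
    fun x x' => (norm_smul_sub_smul_le (h0 x) (h0 x') (hB _) (hB _)).1
  have hge : ∀ x x' : WarpedCone S hY,
      min x.height x'.height *
        ‖φ x.base - φ x'.base‖ ≤
      ‖(x.height : ℂ) • φ x.base -
        (x'.height : ℂ) • φ x'.base‖ + |x.height - x'.height| * B' :=
    fun x x' => (norm_smul_sub_smul_le (h0 x) (h0 x') (hB _) (hB _)).2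
  have hm : ∀ x x' : WarpedCone S hY, 0 ≤ min x.height x'.height :=
    fun x x' => le_min (h0 x) (h0 x')
  -- The upper estimate needs `max K (1 + B')` and the lower one `1 + K' * (1 + B')`; the sum serves
  -- both.
  refine ⟨WithLp 2 (E × ℂ), inferInstance, inferInstance, inferInstance, π', Φ,
    1 + (K + B' + K' * (1 + B')), ?_, ?_, ?_, ?_, ?_⟩
  · have : 0 ≤ (K : ℝ) + B' + K' * (1 + B') := by positivity
    linarith
  · intro γ x
    refine (WithLp.ofLp_injective 2) (Prod.ext ?_ ?_) <;> simp [Φ, Ψ, π', hπ, -Complex.coe_smul]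
  · intro x x'
    have h1 := hle x x'
    have h2 := hK.dist_le_mul x.base x'.base
    rw [dist_eq_norm] at h2
    have h3 : ‖Φ x - Φ x'‖ ≤ ‖(x.height : ℂ) • φ x.base -
        (x'.height : ℂ) • φ x'.base‖ +
      |x.height - x'.height| := by
      refine abs_le_of_sq_le_sq' ?_ (by positivity) |>.2
      rw [hΦsq, add_sq]
      have : 0 ≤ 2 * ‖(x.height : ℂ) • φ x.base -
        (x'.height : ℂ) • φ x'.base‖ *
          |x.height - x'.height| := by positivity
      linarith
    have h4 := mul_le_mul_of_nonneg_left h2 (hm x x')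
    have h5 : 0 ≤ (1 + B' + K' * (1 + B')) * (min x.height x'.height *
        dist x.base x'.base) :=
      mul_nonneg (by positivity) (mul_nonneg (hm x x') dist_nonneg)
    have h6 : 0 ≤ (K + K' * (1 + B')) * |x.height - x'.height| := by
      positivity
    unfold WarpedCone.coneDist
    linarith
  · intro x x'
    have h1 := hge x x'
    have h2 := hK'.le_mul_dist x.base x'.base
    rw [dist_eq_norm (φ _)] at h2
    have h3 : ‖(x.height : ℂ) • φ x.base -
        (x'.height : ℂ) • φ x'.base‖ ≤ ‖Φ x - Φ x'‖ := by
      refine abs_le_of_sq_le_sq' ?_ (by positivity) |>.2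
      rw [hΦsq]
      exact le_add_of_nonneg_right (by positivity)
    have h4 : |x.height - x'.height| ≤ ‖Φ x - Φ x'‖ := by
      refine abs_le_of_sq_le_sq' ?_ (by positivity) |>.2
      rw [hΦsq]
      exact le_add_of_nonneg_left (by positivity)
    have h5 : min x.height x'.height *
        dist x.base x'.base ≤ K' * ((1 + B') * ‖Φ x - Φ x'‖) := by
      calc _ ≤ min x.height x'.height *
            (K' * ‖φ x.base - φ x'.base‖) :=
          mul_le_mul_of_nonneg_left h2 (hm x x')
        _ = K' * (min x.height x'.height *
            ‖φ x.base - φ x'.base‖) := by ring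
        _ ≤ K' * ((1 + B') * ‖Φ x - Φ x'‖) := by
          refine mul_le_mul_of_nonneg_left ?_ K'.2
          have := mul_le_mul_of_nonneg_right h4 hB0
          linarith
    have h6 : 0 ≤ (K + B') * ‖Φ x - Φ x'‖ := by positivity
    unfold WarpedCone.coneDist
    linarith
  · exact (TopologicalSpace.isSeparable_range hΨ).mono (by rintro _ ⟨x, rfl⟩; exact ⟨_, rfl⟩)

end ConeEmbedding

/-! ### Transport costs and the uniqueness of cheap group elements. -/

section Transport

variable {Γ Y E : Type*} [Group Γ] [MetricSpace Y] [MulAction Γ Y] {S : Set Γ}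
  {hY : ∀ y y' : Y, dist y y' ≤ 2} [NormedAddCommGroup E]

/-- The cost of moving `x` to `x'` by the action of `γ` followed by a move in the cone. -/
noncomputable def moveCost (Φ : WarpedCone S hY → E) (γ : Γ) (x x' : WarpedCone S hY) : ℝ :=
  wordLength S γ + ‖Φ (γ • x) - Φ x'‖

theorem moveCost_nonneg (Φ : WarpedCone S hY → E) (γ : Γ) (x x' : WarpedCone S hY) :
    0 ≤ moveCost Φ γ x x' := by
  unfold moveCost
  positivity

variable {Φ : WarpedCone S hY → E}

theorem dist_le_moveCost (hS : ∀ s ∈ S, s⁻¹ ∈ S) (hgen : Subgroup.closure S = ⊤) {A : ℝ}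
    (hΦ : ∀ x x', x.coneDist x' ≤ A * ‖Φ x - Φ x'‖) (γ : Γ) (x x' : WarpedCone S hY) :
    dist x x' ≤ wordLength S γ + A * ‖Φ (γ • x) - Φ x'‖ :=
  (dist_triangle x (γ • x) x').trans (add_le_add (WarpedCone.dist_smul_le hS hgen γ x)
    ((WarpedCone.dist_le _ _).trans (hΦ _ _)))

/-- At large heights, only the identity moves a point close to itself. -/
theorem exists_height_moveCost_lt_imp_eq_one [CompactSpace Y] [ContinuousConstSMul Γ Y]
    (hSfin : S.Finite) (hS : ∀ s ∈ S, s⁻¹ ∈ S) (hgen : Subgroup.closure S = ⊤)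
    (hfree : FreeAction Γ Y) {A : ℝ} (hA : 1 ≤ A)
    (hΦ : ∀ x x', x.coneDist x' ≤ A * ‖Φ x - Φ x'‖) (N : ℝ) :
    ∃ t : ℝ, ∀ (x : WarpedCone S hY) (γ : Γ), t < x.height → moveCost Φ γ x x < N → γ = 1 := by
  have h1 : ∀ γ : Γ, ∃ t : ℝ, ∀ x : WarpedCone S hY, t < x.height → moveCost Φ γ x x < N →
      γ = 1 := by
    intro γ
    by_cases hγ : γ = 1
    · exact ⟨0, fun _ _ _ => hγ⟩
    -- By compactness, an element without fixed points displaces all of `Y` by at least some `δ >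
    -- 0`; at height `t` this becomes `t * δ` in the cone.
    obtain ⟨δ, hδ, h⟩ : ∃ δ > 0, ∀ y : Y, δ ≤ dist (γ • y) y := by
      rcases isEmpty_or_nonempty Y with hE | hE
      · exact ⟨1, one_pos, fun y => (hE.false y).elim⟩
      obtain ⟨y₀, -, hy₀⟩ := isCompact_univ.exists_isMinOn (Set.univ_nonempty (α := Y))
        (f := fun y => dist (γ • y) y) (by fun_prop)
      refine ⟨dist (γ • y₀) y₀, dist_pos.2 fun h => hγ (hfree γ y₀ h), fun y => hy₀ trivial⟩
    refine ⟨A * N / δ, fun x hx hc => absurd hx ?_⟩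
    have h2 := hΦ (γ • x) x
    have h3 := h x.base
    have h4 : x.coneDist x = 0 := by simp [WarpedCone.coneDist]
    have h5 : ‖Φ (γ • x) - Φ x‖ ≤ N := by
      unfold moveCost at hc
      have : (0 : ℝ) ≤ wordLength S γ := by positivity
      linarith
    have h6 : (γ • x).coneDist x = x.height * dist (γ • x.base) x.base := by
      simp [WarpedCone.coneDist]
    have h7 := x.one_le_height
    rw [not_lt, le_div_iff₀ hδ]
    calc x.height * δ ≤ x.height * dist (γ • x.base) x.base := by gcongr
      _ ≤ A * ‖Φ (γ • x) - Φ x‖ := h6 ▸ h2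
      _ ≤ A * N := by gcongr
  choose t ht using h1
  -- A cost below `N` bounds the word length, so only finitely many thresholds have to be exceeded.
  have hf := finite_wordLength_le hSfin hS hgen ⌊N⌋₊
  obtain ⟨T, hT⟩ := (hf.image t).bddAbove
  refine ⟨T, fun x γ hx hc => ht γ x (lt_of_le_of_lt (hT ⟨γ, ?_, rfl⟩) hx) hc⟩
  refine Nat.le_floor ?_
  have := norm_nonneg (Φ (γ • x) - Φ x)
  unfold moveCost at hc
  linarith

variable [InnerProductSpace ℂ E] {π : Γ → (E →ₗᵢ[ℂ] E)}

theorem norm_smul_sub_smul_eq (hπ : ∀ γ x, Φ (γ • x) = π γ (Φ x)) (γ : Γ)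
    (x x' : WarpedCone S hY) : ‖Φ (γ • x) - Φ (γ • x')‖ = ‖Φ x - Φ x'‖ := by
  rw [hπ, hπ, ← map_sub, LinearIsometry.norm_map]

theorem moveCost_mul_le (hS : ∀ s ∈ S, s⁻¹ ∈ S) (hgen : Subgroup.closure S = ⊤)
    (hπ : ∀ γ x, Φ (γ • x) = π γ (Φ x)) (γ η : Γ) (x x' x'' : WarpedCone S hY) :
    moveCost Φ (γ * η) x x'' ≤ moveCost Φ η x x' + moveCost Φ γ x' x'' := by
  have h1 : (wordLength S (γ * η) : ℝ) ≤ wordLength S γ + wordLength S η := by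
    exact_mod_cast wordLength_mul_le hS hgen γ η
  have h2 := norm_smul_sub_smul_eq hπ γ (η • x) x'
  have h3 := norm_sub_le_norm_sub_add_norm_sub (Φ (γ • η • x)) (Φ (γ • x')) (Φ x'')
  unfold moveCost
  rw [mul_smul]
  linarith

theorem moveCost_inv (hS : ∀ s ∈ S, s⁻¹ ∈ S) (hgen : Subgroup.closure S = ⊤)
    (hπ : ∀ γ x, Φ (γ • x) = π γ (Φ x)) (γ : Γ) (x x' : WarpedCone S hY) :
    moveCost Φ γ⁻¹ x' x = moveCost Φ γ x x' := by
  unfold moveCost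
  rw [wordLength_inv hS hgen, ← norm_smul_sub_smul_eq hπ γ, smul_inv_smul, norm_sub_rev]

theorem moveCost_inv_mul_le (hS : ∀ s ∈ S, s⁻¹ ∈ S) (hgen : Subgroup.closure S = ⊤)
    (hπ : ∀ γ x, Φ (γ • x) = π γ (Φ x)) (γ η : Γ) (x x' x'' : WarpedCone S hY) :
    moveCost Φ (γ⁻¹ * η) x x'' ≤ moveCost Φ η x x' + moveCost Φ γ x'' x' := by
  rw [← moveCost_inv hS hgen hπ γ]
  exact moveCost_mul_le hS hgen hπ _ _ _ _ _

/-- The infimum of the costs over `Γ`, divided by `A`, is a pseudometric admissible in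
`WarpedCone.le_dist`. The summand `1` pays for choosing an element near the infimum. -/
theorem exists_moveCost_lt (hS : ∀ s ∈ S, s⁻¹ ∈ S) (hgen : Subgroup.closure S = ⊤)
    (hπ : ∀ γ x, Φ (γ • x) = π γ (Φ x)) {A : ℝ} (hA : 1 ≤ A)
    (hΦ : ∀ x x', ‖Φ x - Φ x'‖ ≤ A * x.coneDist x') (x x' : WarpedCone S hY) :
    ∃ γ, moveCost Φ γ x x' < A * dist x x' + 1 := by
  have hbdd : ∀ x x', BddBelow (Set.range fun γ => moveCost Φ γ x x') := fun x x' =>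
    ⟨0, by rintro _ ⟨γ, rfl⟩; exact moveCost_nonneg Φ γ x x'⟩
  have hA0 : 0 < A := by linarith
  let f : WarpedCone S hY → WarpedCone S hY → ℝ := fun x x' => (⨅ γ, moveCost Φ γ x x') / A
  have hf : ∀ x x' γ, f x x' ≤ moveCost Φ γ x x' / A := fun x x' γ =>
    div_le_div_of_nonneg_right (ciInf_le (hbdd x x') γ) hA0.le
  have hf1 : ∀ x x', f x x' ≤ ‖Φ x - Φ x'‖ / A := fun x x' => by
    have := hf x x' 1
    rwa [moveCost, wordLength_one, one_smul, Nat.cast_zero, zero_add] at this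
  have hnn : ∀ x x', 0 ≤ f x x' := fun x x' =>
    div_nonneg (le_ciInf fun γ => moveCost_nonneg Φ γ x x') hA0.le
  have hsymm : ∀ x x', f x x' ≤ f x' x := fun x x' => by
    refine div_le_div_of_nonneg_right (le_ciInf fun γ => ?_) hA0.le
    rw [← moveCost_inv hS hgen hπ]
    exact ciInf_le (hbdd x x') _
  have key : f x x' ≤ dist x x' := by
    refine WarpedCone.le_dist f (fun x => ?_) (fun x x' => le_antisymm (hsymm x x') (hsymm x' x))
      (fun x y z => ?_) (fun x x' => ?_) (fun s hs x => ?_) x x'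
    · exact le_antisymm (by simpa using hf1 x x) (hnn x x)
    · rw [← add_div]
      refine div_le_div_of_nonneg_right (le_ciInf_add_ciInf fun γ η => ?_) hA0.le
      exact (ciInf_le (hbdd x z) (η * γ)).trans (moveCost_mul_le hS hgen hπ _ _ _ _ _)
    · exact (hf1 x x').trans ((div_le_iff₀' hA0).2 (hΦ x x'))
    · refine (hf x (s • x) s).trans ((div_le_one₀ hA0).2 ?_)
      have : wordLength S s ≤ 1 := wordLength_le_one hs
      have : (wordLength S s : ℝ) ≤ 1 := by exact_mod_cast this
      simp only [moveCost, sub_self, norm_zero]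
      linarith
  obtain ⟨γ, hγ⟩ := exists_lt_of_ciInf_lt (f := fun γ => moveCost Φ γ x x')
    (show _ < A * dist x x' + 1 by
      have := (div_le_iff₀' hA0).1 key
      linarith)
  exact ⟨γ, hγ⟩

end Transport

/-! ### From a proper affine action to a fibred coarse embedding. -/

section FibredEmbedding

open Filter

theorem norm_linearCombination_le_of_comp {P E F : Type*} [NormedAddCommGroup E]
    [InnerProductSpace ℂ E] [NormedAddCommGroup F] [InnerProductSpace ℂ F] (T : E →ₗ[ℂ] F) {L : ℝ}
    (hT : ∀ z, ‖T z‖ ≤ L * ‖z‖) (f : P → F) (g : P → E) (v : P →₀ ℂ)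
    (h : ∀ p ∈ v.support, f p = T (g p)) :
    ‖Finsupp.linearCombination ℂ f v‖ ≤ L * ‖Finsupp.linearCombination ℂ g v‖ := by
  have : Finsupp.linearCombination ℂ f v = Finsupp.linearCombination ℂ (T ∘ g) v := by
    rw [Finsupp.linearCombination_apply, Finsupp.linearCombination_apply]
    exact Finsupp.sum_congr fun p hp => by rw [h p hp, Function.comp_apply]
  rw [this, ← Finsupp.apply_linearCombination]
  exact hT _

theorem hasUBFibredCoarseEmbedding_of_isEmpty (X : Type u) [MetricSpace X] [IsEmpty X] :
    HasUBFibredCoarseEmbedding.{w₃} X := by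
  obtain ⟨H, i1, i2, i3, i4, -⟩ := exists_linearIsometryEquiv_universe.{w₃} ℂ
  have h1 : Tendsto (fun u : ℝ≥0 => (u : ℝ)) atTop atTop := NNReal.tendsto_coe_atTop.2 tendsto_id
  refine ⟨H, i1, i2, i3, i4, fun _ => H, fun _ => i1, fun _ => i2, fun _ => i3, fun _ => 0, 1,
    (↑), (↑), one_pos, NNReal.coe_mono, h1, NNReal.coe_mono, h1, fun r _ => ⟨∅, by simp,
    fun _ _ => AffineEquiv.refl ℂ H, fun _ x => isEmptyElim x.1, fun _ x => isEmptyElim x.1,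
    fun _ _ h => isEmptyElim h.some⟩⟩

/-- Only finitely many `γ` have `a γ ≤ R`; their `ℓ γ` are bounded, so for large `u` the second term
exceeds `R` for them. -/
theorem tendsto_iInf_max_atTop {Γ : Type*} [Nonempty Γ] (a : Γ → ℝ) (ℓ : Γ → ℕ) {A : ℝ}
    (hA : 1 ≤ A) (ha0 : ∀ γ, 0 ≤ a γ) (ha : ∀ R : ℝ, {γ | a γ ≤ R}.Finite) :
    Monotone (fun u : ℝ≥0 => ⨅ γ, max (a γ) ((u - ℓ γ) / A)) ∧
      Tendsto (fun u : ℝ≥0 => ⨅ γ, max (a γ) ((u - ℓ γ) / A)) atTop atTop := by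
  have hbdd : ∀ u : ℝ≥0, BddBelow (Set.range fun γ => max (a γ) ((u - ℓ γ) / A)) := fun u =>
    ⟨0, by rintro _ ⟨γ, rfl⟩; exact le_max_of_le_left (ha0 γ)⟩
  refine ⟨fun u u' h => ciInf_mono (hbdd u) fun γ => ?_, tendsto_atTop.2 fun R => ?_⟩
  · have : (u : ℝ) ≤ u' := h
    gcongr
  · obtain ⟨n, hn⟩ := ((ha R).image ℓ).bddAbove
    filter_upwards [eventually_ge_atTop (Real.toNNReal (n + A * R))] with u hu
    have hu' : n + A * R ≤ u := (Real.le_coe_toNNReal _).trans hu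
    refine le_ciInf fun γ => ?_
    by_cases hγ : a γ ≤ R
    · have h1 : (ℓ γ : ℝ) ≤ n := by exact_mod_cast hn ⟨γ, hγ, rfl⟩
      exact le_max_of_le_right ((le_div_iff₀ (by linarith)).2 (by linarith))
    · exact le_max_of_le_left (not_le.1 hγ).le

theorem LinearizableInHilbert.hasUBFibredCoarseEmbedding {Γ : Type u} [Group Γ] {S : Set Γ}
    (hSfin : S.Finite) (hS : ∀ s ∈ S, s⁻¹ ∈ S) (hgen : Subgroup.closure S = ⊤)
    {Y : Type v} [MetricSpace Y] [CompactSpace Y] (hY : ∀ y y' : Y, dist y y' ≤ 2)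
    [MulAction Γ Y] [ContinuousConstSMul Γ Y] (hfree : FreeAction Γ Y)
    (hlin : LinearizableInHilbert.{w₁} Γ Y) (hmen : UBATMenable.{w₂} Γ) :
    HasUBFibredCoarseEmbedding.{w₃} (WarpedCone S hY) := by
  classical
  rcases isEmpty_or_nonempty (WarpedCone S hY) with hE | ⟨⟨x₀⟩⟩
  · exact hasUBFibredCoarseEmbedding_of_isEmpty _
  have := countable_of_finite_generating hSfin hS hgen
  obtain ⟨E, i1, i2, i3, π, Φ, A, hA, hπ, hΦ₁, hΦ₂, hsep⟩ := hlin.exists_cone_embedding S hY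
  obtain ⟨H, j1, j2, j3, α, ⟨L₀, -, hL₀⟩, hprop⟩ := hmen
  obtain ⟨L, hL1, hL⟩ : ∃ L : ℝ, 1 ≤ L ∧ ∀ γ, AffineNormLE L (α γ) :=
    ⟨max L₀ 1, le_max_right _ _, fun γ => (hL₀ γ).mono (le_max_left _ _)⟩
  have hL0 : 0 < L := by linarith
  have hα : ∀ R : ℝ, {γ | ‖α γ 0‖ ≤ R}.Finite := fun R => by
    refine (hprop (Metric.closedBall 0 R) Metric.isBounded_closedBall).subset fun γ hγ => ?_
    have hγ : ‖α γ 0‖ ≤ R := hγ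
    have hR : 0 ≤ R := (norm_nonneg _).trans hγ
    exact ⟨α γ 0, ⟨0, Metric.mem_closedBall_self hR, rfl⟩, by simpa using hγ⟩
  let b : Γ × WarpedCone S hY → WithLp 2 (H × E) := fun p => WithLp.toLp 2 (α p.1 0, Φ p.2)
  have hb : TopologicalSpace.IsSeparable (Set.range b) := by
    have : Set.range b = ⋃ γ, (fun e => WithLp.toLp 2 (α γ 0, e)) '' Set.range Φ := by
      ext z
      simp [b]
    rw [this]
    exact .iUnion fun γ => hsep.image (by fun_prop)
  -- The product action already exists; the criterion is used to restrict it to a separable space in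
  -- the required universe.
  obtain ⟨H', k1, k2, k3, k4, α', b', hα', hαb, hb'⟩ :=
    exists_affineAction_of_linearCombination_le.{w₃} (Γ := Γ) b hb (1, x₀) L (by
      intro γ v
      let T : WithLp 2 (H × E) →ₗ[ℂ] WithLp 2 (H × E) :=
        { toFun := fun z => WithLp.toLp 2 ((α γ).linear z.fst, π γ z.snd)
          map_add' := fun z w => by
            refine (WithLp.ofLp_injective 2) (Prod.ext ?_ ?_) <;> simp
          map_smul' := fun c z => by
            refine (WithLp.ofLp_injective 2) (Prod.ext ?_ ?_) <;> simp }
      refine norm_linearCombination_le_of_comp T (fun z => ?_) _ _ v (fun p _ => ?_)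
      · refine abs_le_of_sq_le_sq' ?_ (by positivity) |>.2
        rw [mul_pow, WithLp.prod_norm_sq_eq_of_L2, WithLp.prod_norm_sq_eq_of_L2 z, mul_add]
        have h1 := hL γ z.fst
        have h2 : ‖π γ z.snd‖ ≤ L * ‖z.snd‖ := by
          rw [LinearIsometry.norm_map]
          exact le_mul_of_one_le_left (norm_nonneg _) hL1
        have h3 := pow_le_pow_left₀ (norm_nonneg _) h1 2
        have h4 := pow_le_pow_left₀ (norm_nonneg _) h2 2
        rw [mul_pow] at h3 h4
        exact add_le_add h3 h4
      · refine (WithLp.ofLp_injective 2) (Prod.ext ?_ ?_)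
        · have := (α γ).toAffineMap.linearMap_vsub (α p.1 0) (α 1 0)
          simpa [b, T] using this.symm
        · simp [b, T, hπ])
  have hmul : ∀ γ η v, α (γ * η) v = α γ (α η v) := fun γ η v => by
    rw [map_mul]
    rfl
  -- Distances between translated sections depend, up to `L`, only on the relative element `γ'⁻¹ *
  -- γ`: on its displacement of `0` and on how well it carries `x` to `x'`.
  have hest : ∀ (γ γ' : Γ) (x x' : WarpedCone S hY),
      ‖α (γ'⁻¹ * γ) 0‖ / L ≤ ‖b' (γ, γ • x) - b' (γ', γ' • x')‖ ∧
      ‖Φ ((γ'⁻¹ * γ) • x) - Φ x'‖ ≤ ‖b' (γ, γ • x) - b' (γ', γ' • x')‖ ∧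
      ‖b' (γ, γ • x) - b' (γ', γ' • x')‖ ≤
        L * ‖α (γ'⁻¹ * γ) 0‖ + ‖Φ ((γ'⁻¹ * γ) • x) - Φ x'‖ := by
    intro γ γ' x x'
    have h1 : ‖α γ 0 - α γ' 0‖ ≤ L * ‖α (γ'⁻¹ * γ) 0‖ := by
      have := (hL γ').norm_sub_le (α (γ'⁻¹ * γ) 0) 0
      rwa [← hmul, mul_inv_cancel_left, sub_zero] at this
    have h2 : ‖α (γ'⁻¹ * γ) 0‖ ≤ L * ‖α γ 0 - α γ' 0‖ := by
      have := (hL γ'⁻¹).norm_sub_le (α γ 0) (α γ' 0)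
      have h1 : α 1 0 = 0 := by
        rw [map_one]
        rfl
      rwa [← hmul, ← hmul, inv_mul_cancel, h1, sub_zero] at this
    have h3 : ‖Φ (γ • x) - Φ (γ' • x')‖ = ‖Φ ((γ'⁻¹ * γ) • x) - Φ x'‖ := by
      rw [← norm_smul_sub_smul_eq hπ γ' ((γ'⁻¹ * γ) • x), smul_smul, mul_inv_cancel_left]
    have h4 : ‖b (γ, γ • x) - b (γ', γ' • x')‖ ^ 2 =
        ‖α γ 0 - α γ' 0‖ ^ 2 + ‖Φ ((γ'⁻¹ * γ) • x) - Φ x'‖ ^ 2 := by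
      rw [WithLp.prod_norm_sq_eq_of_L2, ← h3]
      rfl
    rw [hb']
    refine ⟨?_, ?_, ?_⟩
    · refine ((div_le_iff₀' hL0).2 h2).trans (abs_le_of_sq_le_sq' ?_ (norm_nonneg _)).2
      rw [h4]
      exact le_add_of_nonneg_right (by positivity)
    · refine (abs_le_of_sq_le_sq' ?_ (norm_nonneg _)).2
      rw [h4]
      exact le_add_of_nonneg_left (by positivity)
    · refine le_trans (abs_le_of_sq_le_sq' ?_ (by positivity)).2 (add_le_add_left h1 _)
      rw [h4, add_sq]
      have : 0 ≤ 2 * ‖α γ 0 - α γ' 0‖ * ‖Φ ((γ'⁻¹ * γ) • x) - Φ x'‖ := by positivity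
      linarith
  let ball : ℕ → Finset Γ := fun n => (finite_wordLength_le hSfin hS hgen n).toFinset
  have hball : Monotone ball := fun m n h => by
    intro γ
    simp only [ball, Set.Finite.mem_toFinset, Set.mem_ofPred_eq]
    exact fun h' => h'.trans h
  let ρ₁ : ℝ≥0 → ℝ := fun u => ⨅ γ, max (‖α γ 0‖ / L) ((u - wordLength S γ) / A)
  -- Points at distance `u` are joined by an element of length at most `A * u + 1`; the sum over
  -- that ball dominates its displacement and is monotone in `u`.
  let ρ₂ : ℝ≥0 → ℝ := fun u => L * ∑ η ∈ ball ⌊A * u + 1⌋₊, ‖α η 0‖ + (A * u + 1)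
  obtain ⟨hρ₁, hρ₁'⟩ := tendsto_iInf_max_atTop (fun γ => ‖α γ 0‖ / L) (wordLength S) hA
    (fun γ => by positivity) (fun R => (hα (R * L)).subset fun γ hγ => by
      exact (div_le_iff₀ hL0).1 hγ)
  have hρ₂ : Monotone ρ₂ := by
    intro u u' h
    have h' : (u : ℝ) ≤ u' := h
    have h2 : ball ⌊A * u + 1⌋₊ ⊆ ball ⌊A * u' + 1⌋₊ := hball (by gcongr)
    have h3 := Finset.sum_le_sum_of_subset_of_nonneg h2
      (f := fun η => ‖α η 0‖) (fun _ _ _ => norm_nonneg _)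
    simp only [ρ₂]
    gcongr
  have hρ₂' : Tendsto ρ₂ atTop atTop := by
    refine tendsto_atTop_mono (fun u => ?_) (NNReal.tendsto_coe_atTop.2 tendsto_id)
    have h1 : 0 ≤ L * ∑ η ∈ ball ⌊A * u + 1⌋₊, ‖α η 0‖ :=
      mul_nonneg hL0.le (Finset.sum_nonneg fun _ _ => norm_nonneg _)
    have h2 : (u : ℝ) ≤ A * u := le_mul_of_one_le_left u.2 hA
    simp only [ρ₂, id]
    linarith
  refine ⟨H', k1, k2, k3, k4, fun _ => H', fun _ => k1, fun _ => k2, fun _ => k3,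
    fun x => b' (1, x), L, ρ₁, ρ₂, hL0, hρ₁, hρ₁', hρ₂, hρ₂', fun r hr => ?_⟩
  -- Within a set of diameter less than `r` each chosen element costs less than `A * r + 1`. A
  -- relative element uses two of these, and comparing two relative elements uses four.
  obtain ⟨t, ht⟩ := exists_height_moveCost_lt_imp_eq_one hSfin hS hgen hfree hA hΦ₂
    (4 * (A * r + 1))
  have hN : 0 < A * r + 1 := by
    have := mul_pos (by linarith : 0 < A) hr
    linarith
  have hconn := exists_moveCost_lt hS hgen hπ hA hΦ₁
  choose g hg using hconn
  let base : Set (WarpedCone S hY) → WarpedCone S hY := fun C =>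
    if h : C.Nonempty then h.some else x₀
  have hbase : ∀ C x, x ∈ C → base C ∈ C := fun C x hx => by
    have h : C.Nonempty := ⟨x, hx⟩
    simp only [base, h, dif_pos]
    exact h.some_mem
  have hdist : ∀ (C : {C : Set (WarpedCone S hY) // C ⊆ {x | x.height ≤ t}ᶜ ∧
      Bornology.IsBounded C ∧ Metric.diam C < r}) (x y), x ∈ C.1 → y ∈ C.1 →
      A * dist x y + 1 < A * r + 1 := fun C x y hx hy => by
    have := (Metric.dist_le_diam_of_mem C.2.2.1 hx hy).trans_lt C.2.2.2
    have := mul_lt_mul_of_pos_left this (by linarith : 0 < A)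
    linarith
  have hht : ∀ (C : {C : Set (WarpedCone S hY) // C ⊆ {x | x.height ≤ t}ᶜ ∧
      Bornology.IsBounded C ∧ Metric.diam C < r}) (x), x ∈ C.1 → t < x.height :=
    fun C x hx => not_le.1 (C.2.1 hx)
  refine ⟨{x | x.height ≤ t}, WarpedCone.isBounded_height_le t,
    fun C x => α' (g x.1 (base C.1)), fun C x => ⟨hα' _, ?_⟩, fun C x y => ?_,
    fun C₁ C₂ hC => ?_⟩
  · have := hα' (g x.1 (base C.1))⁻¹
    rwa [map_inv] at this
  · have hx := (hg x.1 (base C.1)).trans (hdist C _ _ x.2 (hbase _ _ x.2))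
    have hy := (hg y.1 (base C.1)).trans (hdist C _ _ y.2 (hbase _ _ y.2))
    obtain ⟨e1, e2, e3⟩ := hest (g x.1 (base C.1)) (g y.1 (base C.1)) x.1 y.1
    have hαx : ∀ (γ : Γ) (x : WarpedCone S hY), α' γ (b' (1, x)) = b' (γ, γ • x) := fun γ x => by
      rw [hαb, Prod.smul_mk, smul_eq_mul, mul_one]
    rw [hαx, hαx]
    set γ := (g y.1 (base C.1))⁻¹ * g x.1 (base C.1)
    have hγc : moveCost Φ γ x.1 y.1 < 2 * (A * r + 1) := by
      have := moveCost_inv_mul_le hS hgen hπ (g y.1 (base C.1)) (g x.1 (base C.1)) x.1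
        (base C.1) y.1
      linarith
    -- Uniqueness of cheap elements replaces the detour through the base point by the direct choice,
    -- whose cost is governed by the distance from `x` to `y` rather than by `r`.
    have hγg : γ = g x.1 y.1 := by
      have h1 := (hg x.1 y.1).trans (hdist C _ _ x.2 y.2)
      have h2 := moveCost_inv_mul_le hS hgen hπ (g x.1 y.1) γ x.1 y.1 x.1
      have h3 := ht x.1 ((g x.1 y.1)⁻¹ * γ) (hht C _ x.2) (by linarith)
      exact (inv_mul_eq_one.1 h3).symm
    have hγd : moveCost Φ γ x.1 y.1 < A * dist x.1 y.1 + 1 := hγg ▸ hg x.1 y.1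
    have hn := norm_nonneg (Φ (γ • x.1) - Φ y.1)
    unfold moveCost at hγd
    constructor
    · refine (ciInf_le ⟨0, ?_⟩ γ).trans (max_le e1 (le_trans ?_ e2))
      · rintro _ ⟨η, rfl⟩
        exact le_max_of_le_left (by positivity)
      · rw [div_le_iff₀' (by linarith), coe_nndist]
        have := dist_le_moveCost hS hgen hΦ₂ γ x.1 y.1
        linarith
    · refine e3.trans ?_
      have hmem : γ ∈ ball ⌊A * dist x.1 y.1 + 1⌋₊ := by
        simp only [ball, Set.Finite.mem_toFinset, Set.mem_ofPred_eq]
        exact Nat.le_floor (by linarith)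
      have h1 : ‖α γ 0‖ ≤ ∑ η ∈ ball ⌊A * dist x.1 y.1 + 1⌋₊, ‖α η 0‖ :=
        Finset.single_le_sum (f := fun η => ‖α η 0‖) (fun _ _ => norm_nonneg _) hmem
      have h2 : (0 : ℝ) ≤ wordLength S γ := by positivity
      simp only [ρ₂, coe_nndist]
      exact add_le_add (mul_le_mul_of_nonneg_left h1 hL0.le) (by linarith)
  · obtain ⟨z, hz₁, hz₂⟩ := hC
    have key : ∀ x (h₁ : x ∈ C₁.1) (h₂ : x ∈ C₂.1),
        moveCost Φ (g x (base C₁.1) * (g x (base C₂.1))⁻¹) (base C₂.1) (base C₁.1) <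
          2 * (A * r + 1) := by
      intro x h₁ h₂
      have e1 := (hg x (base C₁.1)).trans (hdist C₁ _ _ h₁ (hbase _ _ h₁))
      have e2 := (hg x (base C₂.1)).trans (hdist C₂ _ _ h₂ (hbase _ _ h₂))
      have e3 := moveCost_mul_le hS hgen hπ (g x (base C₁.1)) (g x (base C₂.1))⁻¹ (base C₂.1) x
        (base C₁.1)
      rw [moveCost_inv hS hgen hπ] at e3
      linarith
    refine ⟨α' (g z (base C₁.1) * (g z (base C₂.1))⁻¹), hα' _, ?_, fun x h₁ h₂ => ?_⟩
    · have := hα' (g z (base C₁.1) * (g z (base C₂.1))⁻¹)⁻¹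
      rwa [map_inv] at this
    -- The relative elements at `x` and at `z` both carry one base point near the other, so they
    -- coincide and the transition does not depend on `x`.
    · have e1 := moveCost_inv_mul_le hS hgen hπ (g z (base C₁.1) * (g z (base C₂.1))⁻¹)
        (g x (base C₁.1) * (g x (base C₂.1))⁻¹) (base C₂.1) (base C₁.1) (base C₂.1)
      have e2 := ht (base C₂.1) _ (hht C₂ _ (hbase _ _ h₂))
        (e1.trans_lt (by linarith [key x h₁ h₂, key z hz₁ hz₂]))
      rw [inv_mul_eq_one.1 e2, map_mul, map_inv]
      rfl

end FibredEmbedding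

/-! ### Warped distance and orbits at large height. -/

section NearOrbit

variable {Γ Y : Type*} [Group Γ] [MetricSpace Y] [MulAction Γ Y] {S : Set Γ}
  {hY : ∀ y y' : Y, dist y y' ≤ 2}

theorem exists_modulus [CompactSpace Y] [ContinuousConstSMul Γ Y] (hSfin : S.Finite) {ε c : ℝ}
    (hε : 0 < ε) (hc : 0 < c) :
    ∃ δ > 0, δ ≤ ε ∧ ∀ s ∈ S, ∀ y y' : Y, dist y y' ≤ δ → dist (s • y) (s • y') ≤ c * ε := by
  have h1 : ∀ s : Γ, ∃ δ > 0, ∀ y y' : Y, dist y y' < δ → dist (s • y) (s • y') < c * ε :=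
    fun s => by
      have := CompactSpace.uniformContinuous_of_continuous (continuous_const_smul (T := Y) s)
      obtain ⟨δ, hδ, h⟩ := Metric.uniformContinuous_iff.1 this (c * ε) (by positivity)
      exact ⟨δ, hδ, fun y y' => @h y y'⟩
  choose δ hδ h using h1
  obtain ⟨m, hm, hmS⟩ : ∃ m > 0, ∀ s ∈ S, m ≤ δ s := by
    rcases S.eq_empty_or_nonempty with rfl | hne
    · exact ⟨1, one_pos, by simp⟩
    · obtain ⟨s, -, hs⟩ := S.exists_min_image δ hSfin hne
      exact ⟨δ s, hδ s, hs⟩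
  refine ⟨min (m / 2) ε, by positivity, min_le_right _ _, fun s hs y y' hy => (h s y y' ?_).le⟩
  have := hmS s hs
  have := hy.trans (min_le_left _ _)
  linarith

/-- A decreasing-to-the-left sequence of scales adapted to the action of the generators. -/
theorem exists_scales [CompactSpace Y] [ContinuousConstSMul Γ Y] (hSfin : S.Finite) {ε c : ℝ}
    (hε : 0 < ε) (hc : 0 < c) (N : ℕ) :
    ∃ e : ℕ → ℝ, (∀ k, 0 < e k) ∧ (∀ k, e 0 ≤ e k) ∧ (∀ k, e k ≤ ε) ∧
      ∀ k < N, ∀ s ∈ S, ∀ y y' : Y, dist y y' ≤ e k → dist (s • y) (s • y') ≤ c * e (k + 1) := by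
  induction N with
  | zero => exact ⟨fun _ => ε, fun _ => hε, fun _ => le_rfl, fun _ => le_rfl, by simp⟩
  | succ N ih =>
    obtain ⟨e, h1, h2, h3, h4⟩ := ih
    obtain ⟨δ, hδ, hδe, h⟩ := exists_modulus (Y := Y) hSfin (h1 0) hc
    -- The new scale is put in front: `δ` is chosen for the previous smallest scale `e 0`.
    refine ⟨fun k => if k = 0 then δ else e (k - 1), fun k => ?_, fun k => ?_, fun k => ?_,
      fun k hk s hs y y' hy => ?_⟩
    · dsimp only
      split_ifs
      exacts [hδ, h1 _]
    · change δ ≤ if k = 0 then δ else e (k - 1)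
      split_ifs
      exacts [le_rfl, hδe.trans (h2 _)]
    · dsimp only
      split_ifs
      exacts [hδe.trans (h3 _), h3 _]
    · cases k with
      | zero => simpa using h s hs y y' (by simpa using hy)
      | succ k => simpa using h4 k (by omega) s hs y y' (by simpa using hy)

/-- A function on the warped cone that changes by at most `2` under the generators and is
`1`-Lipschitz for the cone metric is `2`-Lipschitz for the warped metric. -/
theorem WarpedCone.abs_sub_le_two_mul_dist (hS : ∀ s ∈ S, s⁻¹ ∈ S) (F : WarpedCone S hY → ℝ)
    (hF : ∀ x x', F x ≤ F x' + x.coneDist x') (hFs : ∀ s ∈ S, ∀ x, F (s • x) ≤ F x + 2)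
    (x x' : WarpedCone S hY) : |F x - F x'| ≤ 2 * dist x x' := by
  have hcomm : ∀ x x' : WarpedCone S hY, x.coneDist x' = x'.coneDist x := fun x x' => by
    unfold WarpedCone.coneDist
    rw [abs_sub_comm, min_comm, dist_comm]
  have hnn : ∀ x x' : WarpedCone S hY, 0 ≤ x.coneDist x' := fun x x' => by
    have := x.one_le_height
    have := x'.one_le_height
    unfold WarpedCone.coneDist
    positivity
  have h := WarpedCone.le_dist (fun x x' => |F x - F x'| / 2) (by simp)
    (fun x x' => by rw [abs_sub_comm])
    (fun x y z => by
      have := abs_sub_le (F x) (F y) (F z)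
      linarith)
    (fun x x' => by
      have h1 := hF x x'
      have h2 := hF x' x
      rw [hcomm x'] at h2
      have h3 : |F x - F x'| ≤ x.coneDist x' := abs_le.2 ⟨by linarith, by linarith⟩
      have := hnn x x'
      linarith)
    (fun s hs x => by
      have h1 := hFs s hs x
      have h2 := hFs s⁻¹ (hS s hs) (s • x)
      rw [inv_smul_smul] at h2
      have h3 : |F x - F (s • x)| ≤ 2 := abs_le.2 ⟨by linarith, by linarith⟩
      linarith) x x'
  linarith

/-- At large heights, points at warped distance less than `n / 2` have base points that are
close up to the action of a group element of word length less than `n`. -/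
theorem exists_height_near_orbit [CompactSpace Y] [ContinuousConstSMul Γ Y] (hSfin : S.Finite)
    (hS : ∀ s ∈ S, s⁻¹ ∈ S) (hgen : Subgroup.closure S = ⊤) (N : ℕ) {ε : ℝ} (hε : 0 < ε) :
    ∃ t₀ : ℝ, ∀ x x' : WarpedCone S hY, t₀ ≤ x.height → ∀ n ≤ N, 2 * dist x x' < n →
      ∃ γ, wordLength S γ < n ∧ dist (γ • x.base) x'.base ≤ ε := by
  rcases Nat.eq_zero_or_pos N with rfl | hN
  · refine ⟨0, fun x x' _ n hn h => ?_⟩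
    obtain rfl : n = 0 := by omega
    have := dist_nonneg (x := x) (y := x')
    norm_num at h
    linarith
  have hN' : (0 : ℝ) < N := by exact_mod_cast hN
  obtain ⟨e, he, he0, heε, hes⟩ := exists_scales (Y := Y) hSfin hε (inv_pos.2 hN') N
  -- Above height `N / e 0` the cone metric dominates the Lipschitz constant of `f`. The margin `2 *
  -- N` keeps the height cutoff at `x'` above `n`, since the heights differ by less than `n / 2`.
  refine ⟨N / e 0 + 2 * N, fun x x' hx n hn hd => ?_⟩
  let I := {p : ℕ × Γ // wordLength S p.2 ≤ p.1}
  -- The price of reaching `y` by `k` steps and then a jump. A jump of size `e k` costs `N`, so a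
  -- price below `N` forces closeness at scale `e k`.
  let q : I → Y → ℝ := fun p y => p.1.1 + N * dist (p.1.2 • x.base) y / e p.1.1
  let p₀ : I := ⟨(0, 1), by simp [wordLength_one]⟩
  have : Nonempty I := ⟨p₀⟩
  have hq0 : ∀ p y, 0 ≤ q p y := fun p y => by
    have := he p.1.1
    positivity
  have hbdd : ∀ y, BddBelow (Set.range fun p => q p y) := fun y =>
    ⟨0, by rintro _ ⟨p, rfl⟩; exact hq0 p y⟩
  let f : Y → ℝ := fun y => ⨅ p, q p y
  have hf0 : ∀ y, 0 ≤ f y := fun y => le_ciInf fun p => hq0 p y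
  have hfx : f x.base = 0 := by
    refine le_antisymm ((ciInf_le (hbdd _) p₀).trans ?_) (hf0 _)
    simp [q, p₀]
  have hfL : ∀ y y', f y ≤ f y' + N / e 0 * dist y y' := fun y y' => by
    rw [← sub_le_iff_le_add]
    refine le_ciInf fun p => ?_
    rw [sub_le_iff_le_add]
    refine (ciInf_le (hbdd y) p).trans ?_
    have h1 := dist_triangle (p.1.2 • x.base) y' y
    have h2 := he p.1.1
    have h3 : N * dist (p.1.2 • x.base) y / e p.1.1 ≤
        N * dist (p.1.2 • x.base) y' / e p.1.1 + N * dist y' y / e p.1.1 := by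
      rw [← add_div, ← mul_add]
      gcongr
    have h4 : N * dist y' y / e p.1.1 ≤ N / e 0 * dist y y' := by
      rw [dist_comm, div_mul_eq_mul_div]
      have := he 0
      have := he0 p.1.1
      gcongr
    simp only [q]
    linarith
  -- A generator adds one step, and by the choice of scales its new jump costs at most one; this
  -- accounts for the `2`. Truncation at `N` confines the argument to `k < N`, where the scales are
  -- controlled.
  have hfs : ∀ s ∈ S, ∀ y, min (f (s • y)) N ≤ min (f y) N + 2 := fun s hs y => by
    rcases le_or_gt (N : ℝ) (f y) with h | h
    · rw [min_eq_right h]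
      exact (min_le_right _ _).trans (by linarith)
    · rw [min_eq_left h.le]
      refine (min_le_left _ _).trans (le_of_forall_pos_lt_add fun η hη => ?_)
      obtain ⟨⟨⟨k, γ⟩, hγ⟩, hp⟩ := exists_lt_of_ciInf_lt
        (show f y < min (f y + η) N from lt_min (by linarith) h)
      obtain ⟨hp1, hp2⟩ := lt_min_iff.1 hp
      simp only [q] at hp1 hp2
      have hek := he k
      have h0 : 0 ≤ N * dist (γ • x.base) y / e k := by positivity
      have hkN : k < N := by
        have : (k : ℝ) < N := by linarith
        exact_mod_cast this
      have hdist : dist (γ • x.base) y ≤ e k := by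
        have hk0 : (0 : ℝ) ≤ k := by positivity
        have : N * dist (γ • x.base) y / e k < N := by linarith
        rw [div_lt_iff₀ hek] at this
        exact (lt_of_mul_lt_mul_left this hN'.le).le
      have h1 := hes k hkN s hs _ _ hdist
      rw [inv_mul_eq_div, le_div_iff₀' hN'] at h1
      have hmem : wordLength S (s * γ) ≤ k + 1 := by
        have h1 := wordLength_mul_le hS hgen s γ
        have h2 := wordLength_le_one hs
        have h3 : wordLength S γ ≤ k := hγ
        omega
      refine (ciInf_le (hbdd (s • y)) ⟨(k + 1, s * γ), hmem⟩).trans_lt ?_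
      have h2 : N * dist ((s * γ) • x.base) (s • y) / e (k + 1) ≤ 1 := by
        rw [mul_smul, div_le_one₀ (he _)]
        exact h1
      simp only [q]
      push_cast
      linarith
  -- The height factor kills the function at low heights, where `f` need not be `1`-Lipschitz for
  -- the cone metric.
  let F : WarpedCone S hY → ℝ := fun z => min (min (f z.base) N) (max (z.height - N / e 0) 0)
  have hF0 : ∀ z, 0 ≤ F z := fun z => le_min (le_min (hf0 _) hN'.le) (le_max_right _ _)
  have hF : ∀ z z', F z ≤ F z' + z.coneDist z' := fun z z' => by
    have h1 := z.one_le_height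
    have h2 := z'.one_le_height
    have habs := le_abs_self (z.height - z'.height)
    have habs0 := abs_nonneg (z.height - z'.height)
    have hd0 : 0 ≤ min z.height z'.height * dist z.base z'.base := by positivity
    have hmax : max (z.height - N / e 0) 0 ≤
        max (z'.height - N / e 0) 0 + |z.height - z'.height| :=
      max_le (by linarith [le_max_left (z'.height - N / e 0) 0])
        (by linarith [le_max_right (z'.height - N / e 0) 0])
    unfold WarpedCone.coneDist
    rcases le_or_gt (N / e 0) (min z.height z'.height) with h | h
    · have h3 := (hfL z.base z'.base).trans
        (add_le_add_right (mul_le_mul_of_nonneg_right h dist_nonneg) _)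
      rw [← sub_le_iff_le_add]
      refine le_min (le_min ?_ ?_) ?_ <;> rw [sub_le_iff_le_add]
      · exact (min_le_left _ _).trans ((min_le_left _ _).trans (by linarith))
      · exact (min_le_left _ _).trans ((min_le_right _ _).trans (by linarith))
      · exact (min_le_right _ _).trans (by linarith)
    · rcases min_lt_iff.1 h with h | h
      · refine (min_le_right _ _).trans ?_
        rw [max_eq_right (by linarith)]
        linarith [hF0 z']
      · refine (min_le_right _ _).trans ?_
        rw [max_eq_right (by linarith : z'.height - N / e 0 ≤ 0)] at hmax
        linarith [hF0 z']
  have hFs : ∀ s ∈ S, ∀ z, F (s • z) ≤ F z + 2 := fun s hs z => by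
    simp only [F, WarpedCone.base_smul, WarpedCone.height_smul]
    rw [← min_add_add_right]
    exact min_le_min (hfs s hs _) (by linarith)
  have hkey := WarpedCone.abs_sub_le_two_mul_dist hS F hF hFs x x'
  have hFx : F x = 0 := le_antisymm ((min_le_left _ _).trans ((min_le_left _ _).trans hfx.le))
    (hF0 x)
  rw [hFx, zero_sub, abs_neg, abs_of_nonneg (hF0 x')] at hkey
  have hn' : (n : ℝ) ≤ N := by exact_mod_cast hn
  have hh := (abs_le.1 (WarpedCone.abs_height_sub_le x x')).2
  have hfx' : f x'.base < n := by
    by_contra! hcon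
    have : (n : ℝ) ≤ F x' := le_min (le_min hcon hn') (le_max_of_le_left (by linarith))
    linarith
  obtain ⟨⟨⟨k, γ⟩, hγ⟩, hp⟩ := exists_lt_of_ciInf_lt hfx'
  simp only [q] at hp
  have hek := he k
  have h0 : 0 ≤ N * dist (γ • x.base) x'.base / e k := by positivity
  refine ⟨γ, ?_, ?_⟩
  · have h1 : (k : ℝ) < n := by linarith
    have h2 : k < n := by exact_mod_cast h1
    exact lt_of_le_of_lt hγ h2
  · have hk0 : (0 : ℝ) ≤ k := by positivity
    have h1 : N * dist (γ • x.base) x'.base / e k < N := by linarith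
    rw [div_lt_iff₀ hek] at h1
    exact (lt_of_mul_lt_mul_left h1 hN'.le).le.trans (heε k)

end NearOrbit

/-! ### Square-integrable maps, finite nets and separated orbits. -/

section Averaging

open MeasureTheory Filter Topology

/-- Maps that factor through a measurable map to a finite set, as elements of `L²`. -/
theorem exists_linearMap_Lp_of_finite {Y W H : Type*} [MeasurableSpace Y] (μ : Measure Y)
    [IsFiniteMeasure μ] [Finite W] [MeasurableSpace W] [MeasurableSingletonClass W] {w : Y → W}
    (hw : Measurable w) [NormedAddCommGroup H] [InnerProductSpace ℂ H] :
    ∃ J : (W → H) →ₗ[ℂ] Lp H 2 μ, ∀ Ψ, J Ψ =ᵐ[μ] Ψ ∘ w := by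
  have hm : ∀ Ψ : W → H, MemLp (Ψ ∘ w) 2 μ := fun Ψ => by
    obtain ⟨C, hC⟩ := (Set.finite_range fun x => ‖Ψ x‖).bddAbove
    exact MemLp.of_bound
      ((StronglyMeasurable.of_discrete (f := Ψ)).comp_measurable hw).aestronglyMeasurable C
      (.of_forall fun y => hC ⟨w y, rfl⟩)
  exact ⟨{ toFun := fun Ψ => (hm Ψ).toLp
           map_add' := fun Ψ Ψ' => MemLp.toLp_add (hm Ψ) (hm Ψ')
           map_smul' := fun c Ψ => MemLp.toLp_const_smul c (hm Ψ) }, fun Ψ => (hm Ψ).coeFn_toLp⟩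

/-- Chebyshev's inequality gives `c ^ 2 / 2 ≤ ‖f‖ ^ 2`; the factor `2` is a convenient bound for
`√2`. -/
theorem le_two_mul_norm_Lp {Y H : Type*} [MeasurableSpace Y] (μ : Measure Y)
    [NormedAddCommGroup H] (f : Lp H 2 μ) {c : ℝ} {G : Set Y} (hG : 1 / 2 ≤ μ G)
    (h : ∀ᵐ y ∂μ, y ∈ G → c ≤ ‖f y‖) : c ≤ 2 * ‖f‖ := by
  rcases le_or_gt c 0 with hc | hc
  · exact hc.trans (by positivity)
  have h1 := mul_meas_ge_le_pow_eLpNorm' μ (p := 2) two_ne_zero ENNReal.ofNat_ne_top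
    (Lp.aestronglyMeasurable f) (ENNReal.ofReal c)
  have h2 : μ G ≤ μ {y | ENNReal.ofReal c ≤ ‖f y‖ₑ} := by
    refine measure_mono_ae ?_
    filter_upwards [h] with y hy hyG
    have := hy hyG
    change ENNReal.ofReal c ≤ ‖f y‖ₑ
    rw [← ofReal_norm]
    exact ENNReal.ofReal_le_ofReal this
  have h3 := (mul_le_mul_right (hG.trans h2) (ENNReal.ofReal c ^ (2 : ENNReal).toReal)).trans h1
  have h4 : eLpNorm f 2 μ = ENNReal.ofReal ‖f‖ := by
    rw [Lp.norm_def, ENNReal.ofReal_toReal (Lp.eLpNorm_ne_top f)]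
  rw [h4] at h3
  have h5 := ENNReal.toReal_mono (by finiteness) h3
  simp only [ENNReal.toReal_mul, ENNReal.toReal_ofNat, ENNReal.rpow_ofNat, ENNReal.toReal_pow,
    ENNReal.toReal_ofReal hc.le, ENNReal.toReal_ofReal (norm_nonneg f), one_div,
    ENNReal.toReal_inv] at h5
  refine (abs_le_of_sq_le_sq' ?_ (by positivity)).2
  have := sq_nonneg ‖f‖
  rw [mul_pow]
  linarith

theorem exists_measurable_fin_dist_le {Y : Type*} [MetricSpace Y] [CompactSpace Y] [Nonempty Y]
    [MeasurableSpace Y] [BorelSpace Y] {ε : ℝ} (hε : 0 < ε) :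
    ∃ (n : ℕ) (c : Fin n → Y) (i : Y → Fin n), Measurable i ∧ ∀ y, dist (c (i y)) y ≤ ε := by
  let e := TopologicalSpace.denseSeq Y
  obtain ⟨s, hs⟩ := isCompact_univ.elim_finite_subcover (fun k => Metric.ball (e k) ε)
    (fun k => Metric.isOpen_ball) (fun y _ => by
      obtain ⟨k, hk⟩ := (TopologicalSpace.denseRange_denseSeq Y).exists_dist_lt y hε
      exact Set.mem_iUnion.2 ⟨k, hk⟩)
  let N := s.sup id
  refine ⟨N + 1, fun k => e k, fun y => ⟨SimpleFunc.nearestPtInd e N y,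
    Nat.lt_succ_of_le (SimpleFunc.nearestPtInd_le e N y)⟩, ?_, fun y => ?_⟩
  · refine measurable_to_countable' fun k => ?_
    convert (SimpleFunc.nearestPtInd e N).measurableSet_fiber k using 1
    ext y
    simp [Fin.ext_iff]
  · obtain ⟨k, hk, hy⟩ := Set.mem_iUnion₂.1 (hs (Set.mem_univ y))
    have h1 := SimpleFunc.edist_nearestPt_le e y (Finset.le_sup (f := id) hk : k ≤ N)
    rw [edist_dist, edist_dist, ENNReal.ofReal_le_ofReal_iff dist_nonneg] at h1
    rw [Metric.mem_ball, dist_comm] at hy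
    exact h1.trans hy.le

/-- The sets where elements of `A` separate the point by more than `1 / (n + 1)` increase to a set
containing all points with trivial stabilizer, hence of full measure. -/
theorem EssentiallyFreeAction.exists_separated {Γ Y : Type*} [Group Γ] [MetricSpace Y]
    [MulAction Γ Y] [MeasurableSpace Y] {μ : Measure Y}
    [IsProbabilityMeasure μ] (h : EssentiallyFreeAction Γ μ) {A : Set Γ} (hA : A.Finite) :
    ∃ δ > 0, ∃ G : Set Y, 1 / 2 ≤ μ G ∧
      ∀ y ∈ G, ∀ γ ∈ A, ∀ η ∈ A, γ ≠ η → δ < dist (γ • y) (η • y) := by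
  let G : ℕ → Set Y := fun n =>
    {y | ∀ γ ∈ A, ∀ η ∈ A, γ ≠ η → 1 / ((n : ℝ) + 1) < dist (γ • y) (η • y)}
  have hG : Monotone G := fun m n hmn y hy γ hγ η hη hne =>
    (Nat.one_div_le_one_div hmn).trans_lt (hy γ hγ η hη hne)
  have hU : {y : Y | ∃ γ : Γ, γ ≠ 1 ∧ γ • y = y}ᶜ ⊆ ⋃ n, G n := by
    intro y hy
    have h1 : ∀ p : Γ × Γ, p.1 ≠ p.2 → 0 < dist (p.1 • y) (p.2 • y) := fun p hp =>
      dist_pos.2 fun he => hy ⟨p.2⁻¹ * p.1, fun h => hp (inv_mul_eq_one.1 h).symm, by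
        rw [mul_smul, he, inv_smul_smul]⟩
    have h2 : ∀ᶠ n : ℕ in atTop, ∀ p ∈ A ×ˢ A, p.1 ≠ p.2 →
        1 / ((n : ℝ) + 1) < dist (p.1 • y) (p.2 • y) := by
      refine (Set.Finite.eventually_all (hA.prod hA)).2 fun p _ => ?_
      by_cases hp : p.1 = p.2
      · exact .of_forall fun n hn => absurd hp hn
      · filter_upwards [tendsto_one_div_add_atTop_nhds_zero_nat.eventually_lt_const (h1 p hp)]
          with n hn _
        exact hn
    obtain ⟨n, hn⟩ := h2.exists
    exact Set.mem_iUnion.2 ⟨n, fun γ hγ η hη hne => hn (γ, η) ⟨hγ, hη⟩ hne⟩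
  have hμ : μ (⋃ n, G n) = 1 := by
    refine le_antisymm prob_le_one ?_
    have h3 : μ {y : Y | ∃ γ : Γ, γ ≠ 1 ∧ γ • y = y} = 0 := h
    have h4 : (1 : ENNReal) ≤ μ {y : Y | ∃ γ : Γ, γ ≠ 1 ∧ γ • y = y} +
        μ {y : Y | ∃ γ : Γ, γ ≠ 1 ∧ γ • y = y}ᶜ := by
      rw [← measure_univ (μ := μ), ← Set.union_compl_self]
      exact measure_union_le _ _
    rw [h3, zero_add] at h4
    exact h4.trans (measure_mono hU)
  have hlim := tendsto_measure_iUnion_atTop (μ := μ) hG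
  rw [hμ] at hlim
  obtain ⟨n, hn⟩ := (hlim.eventually_const_lt
    (show (1 / 2 : ENNReal) < 1 by simp)).exists
  exact ⟨1 / ((n : ℝ) + 1), by positivity, G n, hn.le, fun y hy => hy⟩

end Averaging

/-! ### Sections trivialized over small sets. -/

section Extraction

/-- The trivialized sections of a uniformly bounded fibred coarse embedding. -/
theorem HasUBFibredCoarseEmbedding.exists_trivialized_sections.{w, x} {X : Type x} [MetricSpace X]
    (h : HasUBFibredCoarseEmbedding.{w} X) :
    ∃ (H : Type w) (_ : NormedAddCommGroup H) (_ : InnerProductSpace ℂ H) (_ : CompleteSpace H)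
      (L : ℝ) (ρ₁ ρ₂ : ℝ≥0 → ℝ), Monotone ρ₁ ∧ Filter.Tendsto ρ₁ Filter.atTop Filter.atTop ∧
      Monotone ρ₂ ∧
      ∀ r : ℝ, 0 < r → ∃ K : Set X, Bornology.IsBounded K ∧ ∃ u : Set X → X → H,
        (∀ C : Set X, C ⊆ Kᶜ → Bornology.IsBounded C → Metric.diam C < r → ∀ x ∈ C, ∀ y ∈ C,
          ρ₁ (nndist x y) ≤ ‖u C x - u C y‖ ∧ ‖u C x - u C y‖ ≤ ρ₂ (nndist x y)) ∧
        ∀ C₁ C₂ : Set X, C₁ ⊆ Kᶜ → Bornology.IsBounded C₁ → Metric.diam C₁ < r →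
          C₂ ⊆ Kᶜ → Bornology.IsBounded C₂ → Metric.diam C₂ < r → (C₁ ∩ C₂).Nonempty →
          ∃ T : H →ₗ[ℂ] H, (∀ v, ‖T v‖ ≤ L * ‖v‖) ∧
            ∀ x ∈ C₁ ∩ C₂, ∀ y ∈ C₁ ∩ C₂, u C₁ x - u C₁ y = T (u C₂ x - u C₂ y) := by
  classical
  obtain ⟨H, i1, i2, i3, -, F, j1, j2, j3, s, L, ρ₁, ρ₂, -, h1, h2, h3, -, hr⟩ := h
  refine ⟨H, i1, i2, i3, L, ρ₁, ρ₂, h1, h2, h3, fun r hr0 => ?_⟩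
  obtain ⟨K, hK, t, -, ha, hb⟩ := hr r hr0
  -- The value `0` outside admissible pairs is never used; it removes the dependent types.
  let u : Set X → X → H := fun C x =>
    if h : (C ⊆ Kᶜ ∧ Bornology.IsBounded C ∧ Metric.diam C < r) ∧ x ∈ C then
      t ⟨C, h.1⟩ ⟨x, h.2⟩ (s x) else 0
  have hu : ∀ C (hC : C ⊆ Kᶜ ∧ Bornology.IsBounded C ∧ Metric.diam C < r) x (hx : x ∈ C),
      u C x = t ⟨C, hC⟩ ⟨x, hx⟩ (s x) := fun C hC x hx => dif_pos ⟨hC, hx⟩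
  refine ⟨K, hK, u, fun C c1 c2 c3 x hx y hy => ?_, fun C₁ C₂ c1 c2 c3 d1 d2 d3 hne => ?_⟩
  · rw [hu C ⟨c1, c2, c3⟩ x hx, hu C ⟨c1, c2, c3⟩ y hy]
    exact ha ⟨C, c1, c2, c3⟩ ⟨x, hx⟩ ⟨y, hy⟩
  · obtain ⟨τ, hτ, -, hτt⟩ := hb ⟨C₁, c1, c2, c3⟩ ⟨C₂, d1, d2, d3⟩ hne
    have key : ∀ x ∈ C₁ ∩ C₂, u C₁ x = τ (u C₂ x) := fun x hx => by
      rw [hu C₁ ⟨c1, c2, c3⟩ x hx.1, hu C₂ ⟨d1, d2, d3⟩ x hx.2, ← hτt x hx.1 hx.2]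
      simp
    refine ⟨τ.linear, hτ, fun x hx y hy => ?_⟩
    rw [key x hx, key y hy]
    exact (τ.toAffineMap.linearMap_vsub _ _).symm

end Extraction

/-! ### Averaging over a level and passing to the limit. -/

section Levels

open MeasureTheory Filter Topology

/-- Averaging a uniformly bounded fibred coarse embedding over a level of the warped cone yields
maps from `Γ` to Hilbert spaces that are uniformly bounded on balls. -/
theorem exists_level_map {Γ : Type u} [Group Γ] {S : Set Γ} (hSfin : S.Finite)
    (hS : ∀ s ∈ S, s⁻¹ ∈ S) (hgen : Subgroup.closure S = ⊤) {Y : Type v} [MetricSpace Y]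
    [CompactSpace Y] {hY : ∀ y y' : Y, dist y y' ≤ 2} [MulAction Γ Y] [ContinuousConstSMul Γ Y]
    [MeasurableSpace Y] [BorelSpace Y] {μ : Measure Y} [IsProbabilityMeasure μ]
    (hμ : ∀ γ : Γ, Measure.map (fun y => γ • y) μ = μ) (hfree : EssentiallyFreeAction Γ μ)
    {H : Type w₃} [NormedAddCommGroup H] [InnerProductSpace ℂ H] {L : ℝ} {ρ₁ ρ₂ : ℝ≥0 → ℝ}
    (hρ₁ : Monotone ρ₁) (hρ₂ : Monotone ρ₂) (N : ℕ) {K : Set (WarpedCone S hY)}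
    (hK : Bornology.IsBounded K) (u : Set (WarpedCone S hY) → WarpedCone S hY → H)
    (hu : ∀ C : Set (WarpedCone S hY), C ⊆ Kᶜ → Bornology.IsBounded C →
      Metric.diam C < 2 * N + 3 → ∀ x ∈ C, ∀ y ∈ C,
        ρ₁ (nndist x y) ≤ ‖u C x - u C y‖ ∧ ‖u C x - u C y‖ ≤ ρ₂ (nndist x y))
    (hT : ∀ C₁ C₂ : Set (WarpedCone S hY), C₁ ⊆ Kᶜ → Bornology.IsBounded C₁ →
      Metric.diam C₁ < 2 * N + 3 → C₂ ⊆ Kᶜ → Bornology.IsBounded C₂ →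
      Metric.diam C₂ < 2 * N + 3 → (C₁ ∩ C₂).Nonempty →
      ∃ T : H →ₗ[ℂ] H, (∀ v, ‖T v‖ ≤ L * ‖v‖) ∧
        ∀ x ∈ C₁ ∩ C₂, ∀ y ∈ C₁ ∩ C₂, u C₁ x - u C₁ y = T (u C₂ x - u C₂ y)) :
    ∃ b : Γ → Lp H 2 μ,
      (∀ (γ : Γ) (v : Γ →₀ ℂ), wordLength S γ ≤ N → (∀ η ∈ v.support, wordLength S η ≤ N) →
        (∀ η ∈ v.support, wordLength S (γ * η) ≤ N) →
        ‖Finsupp.linearCombination ℂ (fun η => b (γ * η) - b γ) v‖ ≤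
          L * ‖Finsupp.linearCombination ℂ (fun η => b η - b 1) v‖) ∧
      ∀ γ, wordLength S γ ≤ N →
        ‖b γ - b 1‖ ≤ max (ρ₂ (wordLength S γ + 2)) 0 ∧
        ρ₁ (Real.toNNReal (wordLength S γ / 2 - 2)) ≤ 2 * ‖b γ - b 1‖ := by
  classical
  have hball := finite_wordLength_le hSfin hS hgen N
  obtain ⟨δ, hδ, G, hG, hGδ⟩ := hfree.exists_separated hball
  obtain ⟨t₀, ht₀⟩ := exists_height_near_orbit (hY := hY) hSfin hS hgen N hδ
  have hYne : Nonempty Y := by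
    by_contra hcon
    rw [not_nonempty_iff] at hcon
    have : μ G = 0 := by rw [Set.eq_empty_of_isEmpty G, measure_empty]
    rw [this] at hG
    simp at hG
  let pt (t : ℝ) (ht : 1 ≤ t) (y : Y) : WarpedCone S hY := MetricCone.mk t ht y
  have y₀ : Y := hYne.some
  obtain ⟨R, hR⟩ := hK.subset_closedBall (pt 1 le_rfl y₀)
  obtain ⟨t, ht1, htt₀, htR⟩ : ∃ t : ℝ, 1 ≤ t ∧ t₀ ≤ t ∧ 1 + R < t :=
    ⟨max 1 (max t₀ (2 + R)), le_max_left _ _, (le_max_left _ _).trans (le_max_right _ _),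
      lt_of_lt_of_le (by linarith) ((le_max_right _ _).trans (le_max_right _ _))⟩
  let p : Y → WarpedCone S hY := pt t ht1
  have hpK : ∀ y, p y ∉ K := fun y hy => by
    have h1 := (WarpedCone.abs_height_sub_le _ _).trans (Metric.mem_closedBall.1 (hR hy))
    have h2 : |t - 1| ≤ R := h1
    linarith [le_abs_self (t - 1)]
  have ht0 : 0 < t := by linarith
  -- A net of mesh `1 / t` has mesh `1` at height `t`. It makes the trivialized sections functions
  -- of finitely many values, so measurability needs no assumption on `u`.
  obtain ⟨n, c, i, hi, hci⟩ := exists_measurable_fin_dist_le (Y := Y) (inv_pos.2 ht0)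
  have hpc : ∀ y, dist (p (c (i y))) (p y) ≤ 1 := fun y => by
    refine (WarpedCone.dist_le _ _).trans ?_
    change |t - t| + min t t * dist (c (i y)) y ≤ 1
    rw [sub_self, abs_zero, min_self, zero_add]
    calc t * dist (c (i y)) y ≤ t * t⁻¹ := by gcongr; exact hci y
      _ = 1 := mul_inv_cancel₀ ht0.ne'
  have hpy : ∀ γ y, dist (p y) (p (γ⁻¹ • y)) ≤ wordLength S γ := fun γ y => by
    have := WarpedCone.dist_smul_le hS hgen γ⁻¹ (p y)
    rwa [wordLength_inv hS hgen] at this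
  let B := {γ : Γ // wordLength S γ ≤ N}
  have : Finite B := hball.to_subtype
  -- All net points near `a⁻¹ y` with `a` in the `N`-ball, recorded at once; the set over which the
  -- section is trivialized depends only on this record.
  let w : Y → B → Fin n := fun y a => i (a.1⁻¹ • y)
  have hw : Measurable w := measurable_pi_lambda _ fun a =>
    hi.comp (continuous_const_smul a.1⁻¹).measurable
  obtain ⟨J, hJ⟩ := exists_linearMap_Lp_of_finite μ hw (H := H)
  let C : (B → Fin n) → Set (WarpedCone S hY) := fun τ => Set.range fun a => p (c (τ a))
  let Ψ : Γ → (B → Fin n) → H := fun γ τ =>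
    if h : wordLength S γ ≤ N then u (C τ) (p (c (τ ⟨γ, h⟩))) else 0
  have hΨ : ∀ γ y, wordLength S γ ≤ N → Ψ γ (w y) = u (C (w y)) (p (c (i (γ⁻¹ • y)))) :=
    fun γ y h => dif_pos h
  have hmem : ∀ γ y, wordLength S γ ≤ N → p (c (i (γ⁻¹ • y))) ∈ C (w y) :=
    fun γ y h => ⟨⟨γ, h⟩, rfl⟩
  have hCK : ∀ τ, C τ ⊆ Kᶜ := by
    rintro τ _ ⟨a, rfl⟩
    exact hpK _
  have hCb : ∀ τ, Bornology.IsBounded (C τ) := fun τ => (Set.finite_range _).isBounded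
  have hdist1 : ∀ γ y, dist (p y) (p (c (i (γ⁻¹ • y)))) ≤ wordLength S γ + 1 := fun γ y => by
    have h1 := dist_triangle (p y) (p (γ⁻¹ • y)) (p (c (i (γ⁻¹ • y))))
    have h2 := hpc (γ⁻¹ • y)
    rw [dist_comm] at h2
    linarith [hpy γ y]
  have hCd : ∀ y, Metric.diam (C (w y)) < 2 * N + 3 := fun y => by
    refine (Metric.diam_le_of_forall_dist_le (C := 2 * N + 2) (by positivity) ?_).trans_lt
      (by linarith)
    rintro _ ⟨a, rfl⟩ _ ⟨a', rfl⟩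
    have h1 := hdist1 a.1 y
    have h2 := hdist1 a'.1 y
    have h3 : (wordLength S a.1 : ℝ) ≤ N := by exact_mod_cast a.2
    have h4 : (wordLength S a'.1 : ℝ) ≤ N := by exact_mod_cast a'.2
    have h5 := dist_triangle_left (p (c (w y a))) (p (c (w y a'))) (p y)
    simp only [w] at h5 ⊢
    linarith
  have h1N : wordLength S (1 : Γ) ≤ N := by simp [wordLength_one]
  have hsub : ∀ f g : (B → Fin n) → H, ∀ᵐ y ∂μ, (J f - J g : Lp H 2 μ) y = f (w y) - g (w y) :=
    fun f g => by
      filter_upwards [Lp.coeFn_sub (J f) (J g), hJ f, hJ g] with y h1 h2 h3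
      rw [h1, Pi.sub_apply, h2, h3]
      rfl
  refine ⟨fun γ => J (Ψ γ), fun γ v hγ hv hγv => ?_, fun γ hγ => ⟨?_, ?_⟩⟩
  · have e1 : Finsupp.linearCombination ℂ (fun η => J (Ψ (γ * η)) - J (Ψ γ)) v =
        J (Finsupp.linearCombination ℂ (fun η => Ψ (γ * η) - Ψ γ) v) := by
      rw [Finsupp.apply_linearCombination]
      congr 2
      ext1 η
      simp
    have e2 : Finsupp.linearCombination ℂ (fun η => J (Ψ η) - J (Ψ 1)) v =
        J (Finsupp.linearCombination ℂ (fun η => Ψ η - Ψ 1) v) := by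
      rw [Finsupp.apply_linearCombination]
      congr 2
      ext1 η
      simp
    rw [e1, e2]
    -- Invariance of `μ` allows the comparison of the left side at `y` with the right side at `γ⁻¹ •
    -- y`.
    have hmp : MeasurePreserving (fun y : Y => γ⁻¹ • y) μ μ :=
      ⟨(continuous_const_smul γ⁻¹).measurable, hμ γ⁻¹⟩
    rw [← Lp.norm_compMeasurePreserving
      (J (Finsupp.linearCombination ℂ (fun η => Ψ η - Ψ 1) v)) hmp]
    refine Lp.norm_le_mul_norm_of_ae_le_mul ?_
    filter_upwards [hJ (Finsupp.linearCombination ℂ (fun η => Ψ (γ * η) - Ψ γ) v),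
      Lp.coeFn_compMeasurePreserving
        (J (Finsupp.linearCombination ℂ (fun η => Ψ η - Ψ 1) v)) hmp,
      hmp.quasiMeasurePreserving.ae (hJ (Finsupp.linearCombination ℂ (fun η => Ψ η - Ψ 1) v))]
      with y h1 h2 h3
    rw [h1, h2, Function.comp_apply, Function.comp_apply, h3, Function.comp_apply]
    have e3 : ∀ (f : Γ → (B → Fin n) → H) (τ : B → Fin n),
        Finsupp.linearCombination ℂ f v τ = Finsupp.linearCombination ℂ (fun η => f η τ) v :=
      fun f τ => by simp [Finsupp.linearCombination_apply, Finsupp.sum]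
    rw [e3, e3]
    have hk1 : p (c (i (γ⁻¹ • y))) = p (c (i ((1 : Γ)⁻¹ • γ⁻¹ • y))) := by
      rw [inv_one, one_smul]
    have hk2 : ∀ η, p (c (i ((γ * η)⁻¹ • y))) = p (c (i (η⁻¹ • γ⁻¹ • y))) := fun η => by
      rw [mul_inv_rev, mul_smul]
    -- The sets attached to `y` and `γ⁻¹ • y` share the net points of `γ⁻¹ • y` and `(γ * η)⁻¹ • y`,
    -- so a single transition map serves the whole combination.
    have hm1 : p (c (i (γ⁻¹ • y))) ∈ C (w y) ∩ C (w (γ⁻¹ • y)) :=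
      ⟨hmem γ y hγ, hk1 ▸ hmem 1 (γ⁻¹ • y) h1N⟩
    obtain ⟨T, hTL, hTe⟩ := hT _ _ (hCK (w y)) (hCb _) (hCd y) (hCK (w (γ⁻¹ • y))) (hCb _)
      (hCd _) ⟨_, hm1⟩
    refine norm_linearCombination_le_of_comp T hTL _ _ v fun η hη => ?_
    have hm2 : p (c (i ((γ * η)⁻¹ • y))) ∈ C (w y) ∩ C (w (γ⁻¹ • y)) :=
      ⟨hmem (γ * η) y (hγv η hη), hk2 η ▸ hmem η (γ⁻¹ • y) (hv η hη)⟩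
    have := hTe _ hm2 _ hm1
    rw [Pi.sub_apply, Pi.sub_apply, hΨ _ _ (hγv η hη), hΨ _ _ hγ, hΨ _ _ (hv η hη),
      hΨ _ _ h1N, this, ← hk1, ← hk2]
  · have h := Lp.norm_le_of_ae_bound (f := J (Ψ γ) - J (Ψ 1)) (p := 2) (μ := μ)
      (le_max_right (ρ₂ (wordLength S γ + 2)) 0) (by
        filter_upwards [hsub (Ψ γ) (Ψ 1)] with y hy
        rw [hy, hΨ _ _ hγ, hΨ _ _ h1N]
        refine ((hu _ (hCK _) (hCb _) (hCd y) _ (hmem γ y hγ) _ (hmem 1 y h1N)).2.trans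
          (hρ₂ ?_)).trans (le_max_left _ _)
        rw [← NNReal.coe_le_coe, coe_nndist]
        push_cast
        have e1 := hdist1 γ y
        have e2 := hdist1 1 y
        rw [wordLength_one, Nat.cast_zero] at e2
        linarith [dist_triangle_left (p (c (i (γ⁻¹ • y)))) (p (c (i ((1 : Γ)⁻¹ • y)))) (p y)])
    simpa [measureUnivNNReal] using h
  · refine le_two_mul_norm_Lp μ _ hG ?_
    filter_upwards [hsub (Ψ γ) (Ψ 1)] with y hy hyG
    rw [hy, hΨ _ _ hγ, hΨ _ _ h1N]
    refine le_trans (hρ₁ ?_) (hu _ (hCK _) (hCb _) (hCd y) _ (hmem γ y hγ) _ (hmem 1 y h1N)).1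
    refine Real.toNNReal_le_iff_le_coe.2 ?_
    rw [coe_nndist]
    -- Otherwise a strictly shorter `η` would bring `y` within `δ` of `γ⁻¹ • y`, contradicting the
    -- separation on `G`.
    have hlow : (wordLength S γ : ℝ) ≤ 2 * dist (p y) (p (γ⁻¹ • y)) := by
      by_contra! hcon
      rw [← wordLength_inv hS hgen] at hγ hcon
      obtain ⟨η, hη, hηd⟩ := ht₀ (p y) (p (γ⁻¹ • y)) htt₀ _ hγ hcon
      have h1 := hGδ y hyG η (hη.le.trans hγ) γ⁻¹ hγ (fun h => by rw [h] at hη; omega)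
      have h2 : dist (η • y) (γ⁻¹ • y) ≤ δ := hηd
      linarith
    have e1 := hpc (γ⁻¹ • y)
    have e2 := hpc y
    have e3 := dist_triangle4 (p y) (p (c (i y))) (p (c (i (γ⁻¹ • y)))) (p (γ⁻¹ • y))
    rw [inv_one, one_smul]
    rw [dist_comm] at e2
    rw [dist_comm (p (c (i (γ⁻¹ • y)))) (p (c (i y)))]
    linarith

theorem HasUBFibredCoarseEmbedding.ubatMenable {Γ : Type u} [Group Γ] {S : Set Γ}
    (hSfin : S.Finite) (hS : ∀ s ∈ S, s⁻¹ ∈ S) (hgen : Subgroup.closure S = ⊤)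
    {Y : Type v} [MetricSpace Y] [CompactSpace Y] {hY : ∀ y y' : Y, dist y y' ≤ 2}
    [MulAction Γ Y] [ContinuousConstSMul Γ Y] [MeasurableSpace Y] [BorelSpace Y]
    {μ : Measure Y} [IsProbabilityMeasure μ]
    (hμ : ∀ γ : Γ, Measure.map (fun y => γ • y) μ = μ) (hfree : EssentiallyFreeAction Γ μ)
    (h : HasUBFibredCoarseEmbedding.{w₃} (WarpedCone S hY)) : UBATMenable.{w₂} Γ := by
  have := countable_of_finite_generating hSfin hS hgen
  obtain ⟨H, i1, i2, i3, L, ρ₁, ρ₂, hρ₁, hρ₁', hρ₂, hr⟩ := h.exists_trivialized_sections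
  have hlev : ∀ N : ℕ, ∃ b : Γ → Lp H 2 μ,
      (∀ (γ : Γ) (v : Γ →₀ ℂ), wordLength S γ ≤ N → (∀ η ∈ v.support, wordLength S η ≤ N) →
        (∀ η ∈ v.support, wordLength S (γ * η) ≤ N) →
        ‖Finsupp.linearCombination ℂ (fun η => b (γ * η) - b γ) v‖ ≤
          L * ‖Finsupp.linearCombination ℂ (fun η => b η - b 1) v‖) ∧
      ∀ γ, wordLength S γ ≤ N →
        ‖b γ - b 1‖ ≤ max (ρ₂ (wordLength S γ + 2)) 0 ∧
        ρ₁ (Real.toNNReal (wordLength S γ / 2 - 2)) ≤ 2 * ‖b γ - b 1‖ := fun N => by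
    -- The discretized `N`-ball orbits have diameter at most `2 * N + 2`.
    obtain ⟨K, hK, u, hu, hT⟩ := hr (2 * N + 3) (by positivity)
    exact exists_level_map hSfin hS hgen hμ hfree hρ₁ hρ₂ N hK u hu hT
  choose b hb hb' using hlev
  let ω : Ultrafilter ℕ := hyperfilter ℕ
  have hω : ∀ k : ℕ, ∀ᶠ N in (ω : Filter ℕ), k ≤ N := fun k =>
    (eventually_ge_atTop k).filter_mono Nat.hyperfilter_le_atTop
  have hωf : ∀ (s : Finset Γ), ∀ᶠ N in (ω : Filter ℕ), ∀ η ∈ s, wordLength S η ≤ N := fun s =>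
    (Finset.eventually_all s).2 fun η _ => hω _
  let T : ∀ _ : ℕ, (Γ →₀ ℂ) →ₗ[ℂ] Lp H 2 μ := fun N =>
    Finsupp.linearCombination ℂ fun η => b N η - b N 1
  obtain ⟨E, j1, j2, j3, U, hU⟩ := exists_hilbert_ultralimit ω (fun _ => Lp H 2 μ) T (fun v => by
    refine ⟨∑ η ∈ v.support, ‖v η‖ * max (ρ₂ (wordLength S η + 2)) 0, ?_⟩
    filter_upwards [hωf v.support] with N hN
    simp only [T, Finsupp.linearCombination_apply, Finsupp.sum]
    refine norm_sum_le_of_le _ fun η hη => ?_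
    rw [norm_smul]
    exact mul_le_mul_of_nonneg_left (hb' N η (hN η hη)).1 (norm_nonneg _))
  have hU1 : U (Finsupp.single 1 1) = 0 := by
    have := hU (Finsupp.single 1 1)
    simp only [T, Finsupp.linearCombination_single, sub_self, smul_zero, norm_zero] at this
    exact norm_eq_zero.1 (tendsto_nhds_unique this tendsto_const_nhds)
  have hlim : ∀ γ, Tendsto (fun N => ‖b N γ - b N 1‖) ω
      (𝓝 ‖U (Finsupp.single γ 1) - U (Finsupp.single 1 1)‖) := fun γ => by
    have := hU (Finsupp.single γ 1)
    simpa [T, hU1] using this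
  refine UBATMenable.of_linearCombination_le.{w₂} (fun η => U (Finsupp.single η 1)) L
    (fun γ v => ?_) fun R => ?_
  · have e1 : Finsupp.linearCombination ℂ
        (fun η => U (Finsupp.single (γ * η) 1) - U (Finsupp.single γ 1)) v =
        U (Finsupp.linearCombination ℂ
          (fun η => Finsupp.single (γ * η) 1 - Finsupp.single γ 1) v) := by
      rw [Finsupp.apply_linearCombination]
      congr 2
      ext1 η
      simp
    have e2 : Finsupp.linearCombination ℂ
        (fun η => U (Finsupp.single η 1) - U (Finsupp.single 1 1)) v = U v := by
      simp only [hU1, sub_zero]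
      rw [show (fun η => U (Finsupp.single η 1)) = U ∘ fun η => Finsupp.single η 1 from rfl,
        ← Finsupp.apply_linearCombination]
      congr 1
      simp [Finsupp.linearCombination_apply]
    rw [e1, e2]
    -- A fixed `γ` and a finitely supported `v` involve finitely many elements, which lie in the
    -- `N`-ball for all large `N`.
    refine le_of_tendsto_of_tendsto (hU _) ((hU v).const_mul L) ?_
    classical
    filter_upwards [hωf v.support, hω (wordLength S γ), hωf (v.support.image (γ * ·))]
      with N h1 h2 h3
    have e3 : T N (Finsupp.linearCombination ℂ
        (fun η => Finsupp.single (γ * η) 1 - Finsupp.single γ 1) v) =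
        Finsupp.linearCombination ℂ (fun η => b N (γ * η) - b N γ) v := by
      rw [Finsupp.apply_linearCombination]
      congr 2
      ext1 η
      simp [T]
    rw [e3]
    exact hb N γ v h2 h1 fun η hη => h3 _ (Finset.mem_image_of_mem _ hη)
  · have hlow : ∀ γ, ρ₁ (Real.toNNReal (wordLength S γ / 2 - 2)) ≤
        2 * ‖U (Finsupp.single γ 1) - U (Finsupp.single 1 1)‖ := fun γ => by
      refine ge_of_tendsto ((hlim γ).const_mul 2) ?_
      filter_upwards [hω (wordLength S γ)] with N hN
      exact (hb' N γ hN).2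
    -- Past `u₀` the lower control exceeds `2 * R`, so `‖b γ - b 1‖ ≤ R` in the limit forces
    -- `wordLength S γ / 2 - 2 < u₀`.
    obtain ⟨u₀, hu₀⟩ := eventually_atTop.1 (hρ₁'.eventually_gt_atTop (2 * R))
    refine (finite_wordLength_le hSfin hS hgen ⌈2 * (u₀ : ℝ) + 4⌉₊).subset fun γ hγ => ?_
    have hγ : ‖U (Finsupp.single γ 1) - U (Finsupp.single 1 1)‖ ≤ R := hγ
    have h1 : Real.toNNReal (wordLength S γ / 2 - 2) < u₀ := by
      by_contra! hcon
      linarith [hu₀ _ hcon, hlow γ]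
    have h2 := (Real.le_coe_toNNReal _).trans_lt (NNReal.coe_lt_coe.2 h1)
    have h3 : (wordLength S γ : ℝ) ≤ ⌈2 * (u₀ : ℝ) + 4⌉₊ :=
      le_trans (by linarith) (Nat.le_ceil _)
    exact_mod_cast h3

end Levels

theorem mainTheorem2 {Γ : Type u} [Group Γ] (S : Set Γ) (hSfin : S.Finite)
    (hSsymm : ∀ s ∈ S, s⁻¹ ∈ S) (hSgen : Subgroup.closure S = ⊤)
    {Y : Type v} [MetricSpace Y] [CompactSpace Y] (hY : ∀ y y' : Y, dist y y' ≤ 2)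
    [MulAction Γ Y] [ContinuousConstSMul Γ Y] [MeasurableSpace Y] [BorelSpace Y] :
    (FreeAction Γ Y → LinearizableInHilbert.{w₁} Γ Y → UBATMenable.{w₂} Γ →
      HasUBFibredCoarseEmbedding.{w₃} (WarpedCone S hY)) ∧
    ((∃ μ : MeasureTheory.Measure Y, MeasureTheory.IsProbabilityMeasure μ ∧
        (∀ γ : Γ, MeasureTheory.Measure.map (fun y => γ • y) μ = μ) ∧
        EssentiallyFreeAction Γ μ) →
      HasUBFibredCoarseEmbedding.{w₃} (WarpedCone S hY) → UBATMenable.{w₂} Γ) := by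
  refine ⟨fun hfree hlin hmen =>
    hlin.hasUBFibredCoarseEmbedding hSfin hSsymm hSgen hY hfree hmen, ?_⟩
  rintro ⟨μ, _, hμ, hfree⟩ hemb
  exact hemb.ubatMenable hSfin hSsymm hSgen hμ hfree
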